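/- **Setting.** Let $d\ge 1$ and let $X$ be a (finite or infinite) abstract simplicial complex on a vertex set $V$: a family of finite subsets of $V$ (cells), closed under taking subsets and containing $\varnothing$. A cell with $j+1$ elements is a $j$-cell, $X^j$ is the set of $j$-cells, and the degree $\deg\sigma$ of a $j$-cell $\sigma$ is the number of $(j+1)$-cells containing it. Assume that $X$ is uniform of dimension $d$ (every cell is contained in a $d$-cell, and $d$ is the maximal dimension of a cell) and that the degrees of the $(d-1)$-cells are globally bounded. *Forms.* An oriented $j$-cell $[\sigma_0,\dots,\sigma_j]$ is an ordering of a $j$-cell up to even permutations; for $j\ge1$ there are two orientations, exchanged by the flip $\sigma\mapsto\overline\sigma$; for $j\le 0$ there is one, and $\overline\sigma=\sigma$. Write $X^j_\pm$ for the set of oriented $j$-cells. A $j$-form is a function $f:X^j_\pm\to\mathbb R$ with $f(\overline\sigma)=-f(\sigma)$ if $j\ge1$ (an arbitrary function if $j\le0$). $\mathbb 1_\sigma$ is the $j$-form with value $1$ at $\sigma$, $-1$ at $\overline\sigma$ (if $j\ge 1$), and $0$ elsewhere. With $w(\sigma)=1/\deg\sigma$ for $\sigma\in X^{d-1}$ and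 $w(\sigma)=1$ for all other cells, let $\Omega^j_{L^2}$ be the real Hilbert space of $j$-forms with $\sum_{\sigma\in X^j}w(\sigma)f(\sigma)^2<\infty$, with inner product $\langle f,g\rangle=\sum_{\sigma\in X^j}w(\sigma)f(\sigma)g(\sigma)$. *Operators.* $\partial_d:\Omega^d_{L^2}\to\Omega^{d-1}_{L^2}$ is the bounded operator $(\partial_df)([\sigma_0,\dots,\sigma_{d-1}])=\sum_v f([v,\sigma_0,\dots,\sigma_{d-1}])$, the sum being over the vertices $v\notin\sigma$ such that $\{v\}\cup\sigma$ is a cell, and $\Delta^+=\partial_d\partial_d^*$ on $\Omega^{d-1}_{L^2}$. For $g\in\Omega^{d-2}_{L^2}$ let $(\delta_{d-1}g)(\sigma)=\deg(\sigma)\sum_{i=0}^{d-1}(-1)^ig([\sigma_0,\dots,\widehat{\sigma_i},\dots,\sigma_{d-1}])$ for $\sigma=[\sigma_0,\dots,\sigma_{d-1}]$. Put $B^{d-1}=\delta_{d-1}(\Omega^{d-2}_{L^2})\cap\Omega^{d-1}_{L^2}$, $Z_{d-1}=(B^{d-1})^\perp$ (orthogonal complement in $\Omega_{L^2}^{d-1}$;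 it is invariant under $\Delta^+$), and $\lambda(X)=\min\operatorname{Spec}(\Delta^+|_{Z_{d-1}})$. *Walk.* An oriented $d$-cell $\tau=[\tau_0,\dots,\tau_d]$ induces on its face $\tau\setminus\{\tau_i\}$ the orientation $(-1)^i[\tau_0,\dots,\widehat{\tau_i},\dots,\tau_d]$ (a sign $-1$ means a flip). Two oriented $(d-1)$-cells $\sigma,\sigma'$ are neighbors, $\sigma\sim\sigma'$, if their underlying cells are different and $\sigma$ and $\overline{\sigma'}$ are both faces, with the induced orientations, of one oriented $d$-cell. (For $d=1$ this is adjacency in a graph.) For $0\le p<1$ the $p$-lazy $(d-1)$-walk is the Markov chain on $X^{d-1}_\pm$ with transition probabilities $p$ from $\sigma$ to $\sigma$, $\frac{1-p}{d\deg\sigma}$ from $\sigma$ to each neighbor of $\sigma$, and $0$ otherwise. Let $\mathbf p_n^{\sigma_0}(\sigma)$ be the probability that the walk started at $\sigma_0$ is at $\sigma$ at time $n$. The expectation process is $\mathcal E_n^{\sigma_0}(\sigma)=\mathbf p_n^{\sigma_0}(\sigma)-\mathbf p_n^{\sigma_0}(\overline\sigma)$ if $d\ge2$, and $\mathcal E_n^{\sigma_0}=\mathbf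 p_n^{\sigma_0}$ if $d=1$; the normalized expectation process is $\widetilde{\mathcal E}_n^{\sigma_0}=\left(\frac d{p(d-1)+1}\right)^n\mathcal E_n^{\sigma_0}$. *Properties.* - $(\mathbf A)$: $\lambda(X)=0$. - $(\mathbf A')$: $\min\operatorname{Spec}\Delta^+=0$. - $(\mathbf T_p)$: $\sum_{n=0}^\infty\widetilde{\mathcal E}_n^\sigma(\sigma)<\infty$ for every $(d-1)$-cell $\sigma$, where the laziness is $p$; and $(\mathbf T)$: $(\mathbf T_p)$ holds for some $\frac12\le p<1$. - $(\mathbf T')$: for every $\sigma\in X^{d-1}_\pm$ there is $f\in\Omega^d_{L^2}$ with $\partial_df=\mathbb 1_\sigma$. - $(\mathbf S)$: all $(d-2)$-cells of $X$ have infinite degree. **Proposition.** Under these assumptions: 1. $(\mathbf A)\Rightarrow(\mathbf A')$. 2. $(\mathbf A')$ and $(\mathbf S)$ together imply $(\mathbf A)$. 3. $\neg(\mathbf A')\Rightarrow(\mathbf T')\Rightarrow(\mathbf S)$. 4. $\neg(\mathbf A')\Rightarrow(\mathbf T)$. 5. If $(\mathbf T_p)$ holds for some $\frac12\le p<1$,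 then it holds for every such $p$. 6. If $0$ is an isolated point of $\operatorname{Spec}\Delta^+$, then $\neg(\mathbf T)$. -/

import Mathlib

/-- An abstract simplicial complex with vertices in `V`: a downward closed family of finite subsets
of `V`, the *cells*.  The empty set is a cell, namely the only `(-1)`-cell (this is why Mathlib's
`PreAbstractSimplicialComplex`, whose faces are nonempty, is not used).
A cell with `j + 1` elements has dimension `j`. -/
structure CellComplex (V : Type*) where
  cells : Set (Finset V)
  empty_mem : ∅ ∈ cells
  down_closed : ∀ s ∈ cells, ∀ t, t ⊆ s → t ∈ cells

namespace CellComplex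

variable {V : Type*} (X : CellComplex V)

/-- The degree of a `j`-cell `c`: the number of `(j+1)`-cells containing it. -/
noncomputable def degree (c : Finset V) : ℕ∞ :=
  {t ∈ X.cells | c ⊆ t ∧ t.card = c.card + 1}.encard

/-- The degree as a real number (only used for cells of finite degree). -/
noncomputable def deg (c : Finset V) : ℝ := ((X.degree c).toNat : ℝ)

/-- `v ◁ c`: the vertex `v` is not in `c`, and `{v} ∪ c` is a cell. -/
def Link (c : Finset V) (v : V) : Prop := ∃ h : v ∉ c, Finset.cons v c h ∈ X.cells

/-- An ordered cell with `n` vertices, i.e. a cell of dimension `n - 1` together with an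
ordering of its vertices. -/
@[ext] structure OrderedCell (n : ℕ) where
  vert : Fin n ↪ V
  mem : Finset.univ.map vert ∈ X.cells

namespace OrderedCell

variable {X} {n : ℕ}

/-- The underlying unordered cell. -/
def cell (s : X.OrderedCell n) : Finset V := Finset.univ.map s.vert

/-- Reordering the vertices of an ordered cell. -/
def perm (s : X.OrderedCell n) (π : Equiv.Perm (Fin n)) : X.OrderedCell n where
  vert := π.toEmbedding.trans s.vert
  mem := by
    have : Finset.univ.map (π.toEmbedding.trans s.vert) = Finset.univ.map s.vert := by
      rw [← Finset.map_map, Finset.map_univ_equiv]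
    rw [this]; exact s.mem

theorem cell_perm (s : X.OrderedCell n) (π : Equiv.Perm (Fin n)) : (s.perm π).cell = s.cell := by
  simp only [cell, perm]
  rw [← Finset.map_map, Finset.map_univ_equiv]

theorem perm_perm (s : X.OrderedCell n) (π ρ : Equiv.Perm (Fin n)) :
    (s.perm π).perm ρ = s.perm (π * ρ) := rfl

theorem perm_one (s : X.OrderedCell n) : s.perm 1 = s := rfl

/-- The ordered cell `σ_0, …, σ̂_i, …, σ_n` obtained by deleting the `i`-th vertex. -/
def face (s : X.OrderedCell (n + 1)) (i : Fin (n + 1)) : X.OrderedCell n where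
  vert := i.succAboveEmb.trans s.vert
  mem := X.down_closed _ s.mem _ (by
    intro x hx
    simp only [Finset.mem_map, Finset.mem_univ, true_and] at hx ⊢
    obtain ⟨j, rfl⟩ := hx
    exact ⟨_, rfl⟩)

/-- The ordered cell `v, σ_0, …, σ_{n-1}`. -/
def cons (s : X.OrderedCell n) (v : V) (h : X.Link s.cell v) : X.OrderedCell (n + 1) where
  vert := ⟨Fin.cons v s.vert, Fin.cons_injective_iff.2 ⟨by
    obtain ⟨h, -⟩ := h
    simpa [cell] using h, s.vert.injective⟩⟩
  mem := by
    obtain ⟨h, h'⟩ := h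
    convert h' using 1
    ext x
    simp [cell, Fin.exists_fin_succ, eq_comm]

/-- Two orderings of a cell define the same orientation if they differ by an even permutation. -/
instance orientationSetoid (X : CellComplex V) (n : ℕ) : Setoid (X.OrderedCell n) where
  r s t := ∃ π : Equiv.Perm (Fin n), Equiv.Perm.sign π = 1 ∧ t = s.perm π
  iseqv :=
    { refl := fun s => ⟨1, by simp, rfl⟩
      symm := by
        rintro s t ⟨π, hπ, rfl⟩
        exact ⟨π⁻¹, by simp [hπ], by rw [perm_perm, mul_inv_cancel, perm_one]⟩
      trans := by
        rintro s t u ⟨π, hπ, rfl⟩ ⟨ρ, hρ, rfl⟩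
        exact ⟨π * ρ, by simp [hπ, hρ], by rw [perm_perm]⟩ }

theorem cell_eq_of_equiv {s t : X.OrderedCell n} (h : s ≈ t) : s.cell = t.cell := by
  obtain ⟨π, -, rfl⟩ := h
  rw [cell_perm]

end OrderedCell

/-- Oriented cells with `n` vertices (dimension `n - 1`): orderings of cells up to even
permutations.  There are two orientations of every cell if `2 ≤ n`, and one if `n ≤ 1`. -/
def OrientedCell (n : ℕ) : Type _ := Quotient (OrderedCell.orientationSetoid X n)

/-- The permutation of the vertices that reverses the orientation: a transposition if there are at
least two vertices (cells of dimension `≥ 1`), and the identity otherwise. -/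
def flipPerm : (n : ℕ) → Equiv.Perm (Fin n)
  | 0 => 1
  | 1 => 1
  | (_ + 2) => Equiv.swap 0 1

theorem sign_flipPerm {n : ℕ} (h : 2 ≤ n) : Equiv.Perm.sign (flipPerm n) = -1 := by
  match n, h with
  | m + 2, _ => simp [flipPerm]

variable {X} {n : ℕ}

/-- The orientation `[σ_0, …, σ_{n-1}]` of an ordered cell. -/
def OrderedCell.oriented (s : X.OrderedCell n) : X.OrientedCell n := Quotient.mk _ s

namespace OrientedCell

/-- The underlying unoriented cell. -/
def cell (σ : X.OrientedCell n) : Finset V :=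
  Quotient.lift OrderedCell.cell (fun _ _ h => OrderedCell.cell_eq_of_equiv h) σ

/-- The flip of orientation `σ ↦ σ̄` (the identity for cells of dimension `≤ 0`, which have only
one orientation). -/
def flip (σ : X.OrientedCell n) : X.OrientedCell n :=
  Quotient.map (fun s : X.OrderedCell n => s.perm (flipPerm n)) (by
    rintro s t ⟨π, hπ, rfl⟩
    refine ⟨(flipPerm n)⁻¹ * π * flipPerm n, ?_, ?_⟩
    · simp [hπ]
    · simp only [OrderedCell.perm_perm, mul_assoc, mul_inv_cancel_left]) σ

/-- `σ.IsFaceOf τ`: the oriented cell `σ` is a face of `τ = [τ_0, …, τ_n]` with the orientation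
induced by `τ`, i.e. `σ = (-1)^i [τ_0, …, τ̂_i, …, τ_n]` for some `i`. -/
def IsFaceOf (σ : X.OrientedCell n) (τ : X.OrientedCell (n + 1)) : Prop :=
  ∃ t : X.OrderedCell (n + 1), t.oriented = τ ∧
    ∃ i : Fin (n + 1), σ = flip^[(i : ℕ)] (t.face i).oriented

/-- The relation `σ ∼ σ'`: there is an oriented cell `τ`, one dimension higher, such that `σ` and
`σ̄'` are two different faces of `τ`, with the orientations induced by it.  (For vertices this is
adjacency in the graph.) -/
def Neighbor (σ σ' : X.OrientedCell n) : Prop :=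
  σ.cell ≠ σ'.cell ∧ ∃ τ : X.OrientedCell (n + 1), σ.IsFaceOf τ ∧ σ'.flip.IsFaceOf τ

open Classical in
/-- The Dirac form `𝟙_σ`. -/
noncomputable def dirac (σ σ' : X.OrientedCell n) : ℝ :=
  if σ' = σ then 1 else if σ' = σ.flip then -1 else 0

end OrientedCell

/-- Forms: functions on oriented cells that are antisymmetric with respect to the flip of
orientation (no condition for cells of dimension `≤ 0`, for which there are no flips). -/
def IsForm (f : X.OrientedCell n → ℝ) : Prop := 2 ≤ n → ∀ σ, f σ.flip = -f σ

theorem IsForm.perm {f : X.OrientedCell n → ℝ} (hf : IsForm f) (s : X.OrderedCell n)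
    (π : Equiv.Perm (Fin n)) :
    f (s.perm π).oriented = ((Equiv.Perm.sign π : ℤ) : ℝ) * f s.oriented := by
  rcases Int.units_eq_one_or (Equiv.Perm.sign π) with h | h
  · rw [h]
    have : (s.perm π).oriented = s.oriented := (Quotient.sound ⟨π, h, rfl⟩ :
      (Quotient.mk _ s : X.OrientedCell n) = Quotient.mk _ (s.perm π)).symm
    simp [this]
  · rw [h]
    match n, f, hf, s, π, h with
    | 0, f, hf, s, π, h => simp [Subsingleton.elim π 1] at h
    | 1, f, hf, s, π, h => simp [Subsingleton.elim π 1] at h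
    | (m + 2), f, hf, s, π, h =>
      have e : (s.perm π).oriented = s.oriented.flip :=
        (Quotient.sound ⟨(flipPerm (m + 2))⁻¹ * π, by simp [h, flipPerm], by
          simp [OrderedCell.perm_perm]⟩ :
          (Quotient.mk _ (s.perm (flipPerm (m + 2))) : X.OrientedCell (m + 2))
            = Quotient.mk _ (s.perm π)).symm
      rw [e, hf (by omega)]
      simp

variable (X) in
/-- An ordered cell `t_0, …, t_n` is the same thing as an ordered cell `s = t_1, …, t_n` together
with a vertex `t_0 ◁ s`. -/
def consEquiv (n : ℕ) :
    (Σ s : X.OrderedCell n, {v // X.Link s.cell v}) ≃ X.OrderedCell (n + 1) where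
  toFun p := p.1.cons p.2.1 p.2.2
  invFun t := ⟨t.face 0, t.vert 0, by
    have h0 : t.vert 0 ∉ (t.face 0).cell := by
      simp [OrderedCell.cell, OrderedCell.face]
    refine ⟨h0, ?_⟩
    convert t.mem using 1
    ext x
    simp [OrderedCell.cell, OrderedCell.face, Fin.exists_fin_succ, eq_comm]⟩
  left_inv := by
    rintro ⟨s, v, h⟩
    rfl
  right_inv := by
    intro t
    ext i
    refine Fin.cases rfl (fun i => rfl) i

theorem degree_eq (c : Finset V) : X.degree c = {v | X.Link c v}.encard := by
  classical
  symm
  rw [degree]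
  have : Set.InjOn (fun v => insert v c) {v | X.Link c v} := by
    rintro v ⟨hv, -⟩ w ⟨hw, -⟩ h
    have h : insert v c = insert w c := h
    have : v ∈ insert w c := h ▸ Finset.mem_insert_self v c
    simpa [hv] using this
  rw [← this.encard_image]
  congr 1
  ext t
  simp only [Set.mem_image, Set.mem_ofPred_eq]
  constructor
  · rintro ⟨v, ⟨hv, h⟩, rfl⟩
    rw [Finset.cons_eq_insert] at h
    exact ⟨h, Finset.subset_insert _ _, Finset.card_insert_of_notMem hv⟩
  · rintro ⟨ht, hct, hcard⟩
    obtain ⟨v, hv⟩ : ∃ v, t \ c = {v} := by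
      rw [← Finset.card_eq_one, Finset.card_sdiff_of_subset hct]; omega
    have hvt : v ∈ t \ c := by rw [hv]; simp
    have e : insert v c = t := by
      rw [← Finset.sdiff_union_of_subset hct, hv]; rfl
    refine ⟨v, ⟨(Finset.mem_sdiff.1 hvt).2, ?_⟩, e⟩
    rw [Finset.cons_eq_insert, e]; exact ht

/-- `(∂f)(σ) = ∑_{v ◁ σ} f(vσ)`, in terms of an ordering of the cell `σ`. -/
noncomputable def boundaryAt (f : X.OrientedCell (n + 1) → ℝ) (s : X.OrderedCell n) : ℝ :=
  ∑' v : {v // X.Link s.cell v}, f (s.cons v v.2).oriented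

theorem cons_perm (s : X.OrderedCell n) (π : Equiv.Perm (Fin n)) (v : V)
    (h : X.Link s.cell v) (h' : X.Link (s.perm π).cell v) :
    (s.perm π).cons v h' = (s.cons v h).perm (Equiv.Perm.decomposeFin.symm (0, π)) := by
  ext i
  refine Fin.cases ?_ (fun i => ?_) i
  · show v = (s.cons v h).vert (Equiv.Perm.decomposeFin.symm (0, π) 0)
    rw [Equiv.Perm.decomposeFin_symm_apply_zero]; rfl
  · show s.vert (π i) = (s.cons v h).vert (Equiv.Perm.decomposeFin.symm (0, π) i.succ)
    rw [Equiv.Perm.decomposeFin_symm_apply_succ]; simp [OrderedCell.cons]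

theorem boundaryAt_perm {f : X.OrientedCell (n + 1) → ℝ} (hf : IsForm f) (s : X.OrderedCell n)
    (π : Equiv.Perm (Fin n)) :
    boundaryAt f (s.perm π) = ((Equiv.Perm.sign π : ℤ) : ℝ) * boundaryAt f s := by
  unfold boundaryAt
  have e : ∀ v, X.Link s.cell v ↔ X.Link (s.perm π).cell v := by
    intro v; rw [OrderedCell.cell_perm]
  rw [← (Equiv.subtypeEquivRight e).tsum_eq, ← tsum_mul_left]
  congr 1
  ext v
  rw [← show Equiv.Perm.sign (Equiv.Perm.decomposeFin.symm (0, π)) = Equiv.Perm.sign π by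
    rw [Equiv.Perm.decomposeFin.symm_sign]; simp, ← hf.perm, ← cons_perm]
  rfl

end CellComplex

/-- A `d`-dimensional simplicial complex (possibly infinite) that is uniform, i.e. every cell is
contained in a cell of dimension `d = dim X`, and whose `(d-1)`-cells have globally bounded
degrees. -/
structure BoundedComplex (V : Type*) (d : ℕ) extends CellComplex V where
  uniform : ∀ s ∈ cells, ∃ t ∈ cells, s ⊆ t ∧ t.card = d + 1
  bounded_degree : ∃ K : ℕ, ∀ s ∈ cells, s.card = d → toCellComplex.degree s ≤ K

namespace BoundedComplex

open CellComplex

variable {V : Type*} {d : ℕ} (X : BoundedComplex V d)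

theorem finite_link {c : Finset V} (hc : c ∈ X.cells) (h : c.card = d) :
    Finite {v // X.Link c v} := by
  obtain ⟨K, hK⟩ := X.bounded_degree
  have := hK c hc h
  rw [degree_eq] at this
  exact (Set.finite_of_encard_le_coe this).to_subtype

theorem deg_eq_card (c : Finset V) : X.deg c = Nat.card {v // X.Link c v} := by
  rw [deg, degree_eq]; rfl

theorem deg_pos {c : Finset V} (hc : c ∈ X.cells) (h : c.card = d) : 0 < X.deg c := by
  have := X.finite_link hc h
  rw [deg_eq_card]
  obtain ⟨t, ht, hct, hcard⟩ := X.uniform c hc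
  obtain ⟨v, hvt, hvc⟩ : ∃ v ∈ t, v ∉ c := by
    by_contra! hh
    have := Finset.card_le_card (show t ⊆ c from hh)
    omega
  have : Nonempty {v // X.Link c v} := ⟨v, hvc, X.down_closed t ht _ (by
    intro x hx
    rcases Finset.mem_cons.1 hx with rfl | hx
    exacts [hvt, hct hx])⟩
  exact_mod_cast Nat.card_pos

/-- The weight function: `1 / deg σ` on `(d-1)`-cells, and `1` on all other cells. -/
noncomputable def weight (c : Finset V) : ℝ := if c.card = d then 1 / X.deg c else 1

theorem weight_pos {n : ℕ} (s : X.OrderedCell n) : 0 < X.weight s.cell := by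
  unfold weight
  split_ifs with h
  · exact one_div_pos.2 (X.deg_pos s.mem h)
  · exact one_pos

/-- The forms of finite norm, `∑_σ w(σ) f(σ)² < ∞`. -/
def l2Submodule (n : ℕ) : Submodule ℝ (X.OrientedCell n → ℝ) where
  carrier := {f | IsForm f ∧ Summable fun s : X.OrderedCell n => X.weight s.cell * f s.oriented ^ 2}
  zero_mem' := ⟨fun _ _ => by simp, by simp⟩
  add_mem' := by
    rintro f g ⟨hf, hf'⟩ ⟨hg, hg'⟩
    refine ⟨fun h σ => by simp [hf h σ, hg h σ]; ring, ?_⟩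
    refine Summable.of_nonneg_of_le (fun s => mul_nonneg (X.weight_pos s).le (sq_nonneg _))
      (fun s => ?_) ((hf'.add hg').mul_left 2)
    have := X.weight_pos s
    simp only [Pi.add_apply]
    nlinarith [mul_nonneg this.le (sq_nonneg (f s.oriented - g s.oriented))]
  smul_mem' := by
    rintro c f ⟨hf, hf'⟩
    refine ⟨fun h σ => by simp [hf h σ], (hf'.mul_left (c ^ 2)).congr fun s => ?_⟩
    simp only [Pi.smul_apply, smul_eq_mul]; ring

/-- The Hilbert space `Ω_{L²}^{n-1}` of square-summable forms on the cells with `n` vertices. -/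
def L2Form (n : ℕ) : Type _ := X.l2Submodule n

namespace L2Form

variable {X} {n : ℕ}

noncomputable instance : AddCommGroup (X.L2Form n) := inferInstanceAs (AddCommGroup (X.l2Submodule n))

noncomputable instance : Module ℝ (X.L2Form n) := inferInstanceAs (Module ℝ (X.l2Submodule n))

/-- The underlying function of a square-summable form. -/
def toFun (f : X.L2Form n) : X.OrientedCell n → ℝ :=
  Subtype.val (show X.l2Submodule n from f)

instance : CoeFun (X.L2Form n) (fun _ => X.OrientedCell n → ℝ) := ⟨toFun⟩

/-- A square-summable form from a function. -/
def mk (f : X.OrientedCell n → ℝ) (hf : IsForm f)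
    (hf' : Summable fun s : X.OrderedCell n => X.weight s.cell * f s.oriented ^ 2) : X.L2Form n :=
  show X.l2Submodule n from ⟨f, hf, hf'⟩

theorem ext {f g : X.L2Form n} (h : ∀ s : X.OrderedCell n, f s.oriented = g s.oriented) :
    f = g := by
  refine Subtype.ext (funext fun σ => ?_)
  induction σ using Quotient.inductionOn with
  | h s => exact h s

@[simp] theorem zero_apply (σ : X.OrientedCell n) : (0 : X.L2Form n) σ = 0 := rfl

theorem isForm (f : X.L2Form n) : IsForm (f : X.OrientedCell n → ℝ) := f.2.1

theorem summable_sq (f : X.L2Form n) :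
    Summable fun s : X.OrderedCell n => X.weight s.cell * f s.oriented ^ 2 := f.2.2

@[simp] theorem add_apply (f g : X.L2Form n) (σ : X.OrientedCell n) : (f + g) σ = f σ + g σ := rfl

@[simp] theorem smul_apply (c : ℝ) (f : X.L2Form n) (σ : X.OrientedCell n) :
    (c • f) σ = c * f σ := rfl

theorem summable_mul (f g : X.L2Form n) :
    Summable fun s : X.OrderedCell n => X.weight s.cell * f s.oriented * g s.oriented := by
  refine Summable.of_norm_bounded (f.summable_sq.add g.summable_sq) (fun s => ?_)
  have := X.weight_pos s
  rw [Real.norm_eq_abs, abs_le]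
  constructor <;>
  nlinarith [mul_nonneg this.le (sq_nonneg (f s.oriented - g s.oriented)),
    mul_nonneg this.le (sq_nonneg (f s.oriented + g s.oriented)),
    mul_nonneg this.le (sq_nonneg (f s.oriented)), mul_nonneg this.le (sq_nonneg (g s.oriented))]

/-- The inner product `⟨f, g⟩ = ∑_σ w(σ) f(σ) g(σ)`, the sum being over all unoriented cells with
`n` vertices: each of them has exactly `n!` orderings, and the summand does not depend on the
ordering. -/
@[reducible] noncomputable def core (X : BoundedComplex V d) (n : ℕ) : InnerProductSpace.Core ℝ (X.L2Form n) where
  inner f g := (1 / (n.factorial : ℝ)) *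
    ∑' s : X.OrderedCell n, X.weight s.cell * f s.oriented * g s.oriented
  conj_inner_symm f g := by
    simp only [conj_trivial, mul_right_comm]
  re_inner_nonneg f := by
    simp only [RCLike.re_to_real]
    refine mul_nonneg (by positivity) (tsum_nonneg fun s => ?_)
    rw [mul_assoc]
    exact mul_nonneg (X.weight_pos s).le (mul_self_nonneg _)
  add_left f g h := by
    rw [← mul_add, ← (f.summable_mul h).tsum_add (g.summable_mul h)]
    refine congrArg _ (tsum_congr fun s => ?_); simp only [add_apply]; ring
  smul_left f g c := by
    simp only [conj_trivial]
    rw [mul_left_comm, ← tsum_mul_left (a := c)]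
    refine congrArg _ (tsum_congr fun s => ?_); simp only [smul_apply]; ring
  definite f h := by
    have h0 : ∀ s : X.OrderedCell n, 0 ≤ X.weight s.cell * f s.oriented * f s.oriented := fun s => by
      rw [mul_assoc]
      exact mul_nonneg (X.weight_pos s).le (mul_self_nonneg _)
    rcases mul_eq_zero.1 h with h | h
    · exact absurd h (by positivity)
    have := ((f.summable_mul f).hasSum_iff.2 h)
    rw [hasSum_zero_iff_of_nonneg h0] at this
    refine ext fun s => ?_
    have hs := congrFun this s
    have hw := (X.weight_pos s).ne'
    simpa [hw] using hs

noncomputable instance : NormedAddCommGroup (X.L2Form n) :=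
  (core X n).toNormedAddCommGroup

noncomputable instance : InnerProductSpace ℝ (X.L2Form n) := 
  InnerProductSpace.ofCore (core X n).toCore

theorem inner_eq (f g : X.L2Form n) : inner ℝ f g = (1 / (n.factorial : ℝ)) *
    ∑' s : X.OrderedCell n, X.weight s.cell * f s.oriented * g s.oriented := rfl

theorem norm_sq_eq (f : X.L2Form n) : ‖f‖ ^ 2 = (1 / (n.factorial : ℝ)) *
    ∑' s : X.OrderedCell n, X.weight s.cell * f s.oriented ^ 2 := by
  rw [← real_inner_self_eq_norm_sq, inner_eq]
  refine congrArg _ (tsum_congr fun s => ?_); ring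

/-- The isometric embedding of `Ω_{L²}` into `ℓ²` of the ordered cells; it is only used to show
that `Ω_{L²}` is complete. -/
noncomputable def toLp (X : BoundedComplex V d) (n : ℕ) :
    X.L2Form n →ₗ[ℝ] lp (fun _ : X.OrderedCell n => ℝ) 2 where
  toFun f := ⟨fun s => √(X.weight s.cell / n.factorial) * f s.oriented, by
    refine (memℓp_gen_iff (by norm_num)).2 ?_
    refine (f.summable_sq.mul_left (1 / (n.factorial : ℝ))).congr fun s => ?_
    have := X.weight_pos s
    simp only [ENNReal.toReal_ofNat, Real.rpow_ofNat, Real.norm_eq_abs, sq_abs, mul_pow]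
    rw [Real.sq_sqrt (by positivity)]; ring⟩
  map_add' f g := by
    ext s
    simp only [add_apply, lp.coeFn_add, Pi.add_apply, mul_add]
  map_smul' c f := by
    ext s
    simp only [smul_apply, lp.coeFn_smul, Pi.smul_apply, smul_eq_mul, RingHom.id_apply]
    ring

theorem norm_toLp (f : X.L2Form n) : ‖toLp X n f‖ = ‖f‖ := by
  rw [← sq_eq_sq₀ (norm_nonneg _) (norm_nonneg _), norm_sq_eq, ← real_inner_self_eq_norm_sq,
    lp.inner_eq_tsum, ← tsum_mul_left]
  refine tsum_congr fun s => ?_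
  have := X.weight_pos s
  rw [real_inner_self_eq_norm_sq, Real.norm_eq_abs, sq_abs]
  show (√(X.weight s.cell / n.factorial) * f s.oriented) ^ 2 = _
  rw [mul_pow, Real.sq_sqrt (by positivity)]; ring

theorem range_toLp : Set.range (toLp X n) = {φ | ∀ (s : X.OrderedCell n) (π : Equiv.Perm (Fin n)),
    φ (s.perm π) = ((Equiv.Perm.sign π : ℤ) : ℝ) * φ s} := by
  have ha : ∀ s : X.OrderedCell n, 0 < √(X.weight s.cell / n.factorial) := fun s => by
    have := X.weight_pos s
    positivity
  ext φ
  constructor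
  · rintro ⟨f, rfl⟩ s π
    show √(X.weight (s.perm π).cell / n.factorial) * f (s.perm π).oriented
      = _ * (√(X.weight s.cell / n.factorial) * f s.oriented)
    rw [OrderedCell.cell_perm, f.isForm.perm]; ring
  · intro hφ
    have hφ : ∀ (s : X.OrderedCell n) (π : Equiv.Perm (Fin n)),
      φ (s.perm π) = ((Equiv.Perm.sign π : ℤ) : ℝ) * φ s := hφ
    let f : X.OrientedCell n → ℝ := Quotient.lift
      (fun s : X.OrderedCell n => φ s / √(X.weight s.cell / n.factorial)) (by
        rintro s t ⟨π, h, rfl⟩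
        simp [OrderedCell.cell_perm, hφ, h])
    have hf : ∀ s : X.OrderedCell n, f s.oriented = φ s / √(X.weight s.cell / n.factorial) :=
      fun s => rfl
    refine ⟨mk f ?_ ?_, ?_⟩
    · intro h2 σ
      induction σ using Quotient.inductionOn with
      | h s =>
        show f (s.perm (flipPerm n)).oriented = - f s.oriented
        rw [hf, hf, hφ, sign_flipPerm h2, OrderedCell.cell_perm]
        simp [neg_div]
    · have := (memℓp_gen_iff (by norm_num)).1 φ.2
      refine (this.mul_left (n.factorial : ℝ)).congr fun s => ?_
      have hw := X.weight_pos s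
      have hfac : (0 : ℝ) < n.factorial := by positivity
      simp only [ENNReal.toReal_ofNat, Real.rpow_ofNat, Real.norm_eq_abs, sq_abs, hf, div_pow]
      rw [Real.sq_sqrt (by positivity)]
      field_simp
    · ext s
      show √(X.weight s.cell / n.factorial) * f s.oriented = φ s
      rw [hf, mul_div_cancel₀ _ (ha s).ne']

instance : CompleteSpace (X.L2Form n) := by
  have hiso : Isometry (toLp X n) := AddMonoidHomClass.isometry_of_norm _ norm_toLp
  rw [completeSpace_iff_isComplete_range hiso.isUniformInducing]
  apply IsClosed.isComplete
  rw [range_toLp]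
  simp only [Set.ofPred_forall]
  refine isClosed_iInter fun s => isClosed_iInter fun π => ?_
  have hc : ∀ s : X.OrderedCell n,
      Continuous fun φ : lp (fun _ : X.OrderedCell n => ℝ) 2 => φ s := fun s =>
    (lp.evalCLM ℝ (fun _ : X.OrderedCell n => ℝ) 2 s).continuous
  exact isClosed_eq (hc _) (continuous_const.mul (hc _))

end L2Form

variable {X}

theorem weight_eq {c : Finset V} (h : c.card = d) : X.weight c = 1 / X.deg c := if_pos h

theorem card_cell {n : ℕ} (s : X.OrderedCell n) : s.cell.card = n := by
  simp [OrderedCell.cell]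

theorem weight_top (t : X.OrderedCell (d + 1)) : X.weight t.cell = 1 :=
  if_neg (by rw [card_cell]; omega)

theorem finite_link_cell (s : X.OrderedCell d) : Finite {v // X.Link s.cell v} :=
  X.finite_link s.mem (card_cell s)

theorem sum_link_const (s : X.OrderedCell d) (c : ℝ) :
    ∑' _ : {v // X.Link s.cell v}, X.weight s.cell * c = c := by
  have := finite_link_cell s
  have h := X.deg_pos s.mem (card_cell s)
  have : Fintype {v // X.Link s.cell v} := Fintype.ofFinite _
  rw [weight_eq (card_cell s)]
  have e : X.deg s.cell = Fintype.card {v // X.Link s.cell v} := by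
    rw [deg_eq_card, Nat.card_eq_fintype_card]
  have h : 0 < X.deg s.cell := h
  rw [tsum_fintype, Finset.sum_const, Finset.card_univ, nsmul_eq_mul, ← e]
  field_simp

theorem weight_mul_boundaryAt_sq_le (f : X.OrientedCell (d + 1) → ℝ) (s : X.OrderedCell d) :
    X.weight s.cell * boundaryAt f s ^ 2
      ≤ ∑' v : {v // X.Link s.cell v}, f (s.cons v v.2).oriented ^ 2 := by
  have := finite_link_cell s
  have h : 0 < X.deg s.cell := X.deg_pos s.mem (card_cell s)
  have : Fintype {v // X.Link s.cell v} := Fintype.ofFinite _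
  rw [weight_eq (card_cell s), boundaryAt, tsum_fintype, tsum_fintype, one_div,
    inv_mul_le_iff₀ h]
  have e : X.deg s.cell = (Finset.univ : Finset {v // X.Link s.cell v}).card := by
    rw [deg_eq_card, Nat.card_eq_fintype_card]; rfl
  rw [e]
  exact sq_sum_le_card_mul_sum_sq

theorem L2Form.summable_sigma (f : X.L2Form (d + 1)) :
    Summable fun p : Σ s : X.OrderedCell d, {v // X.Link s.cell v} =>
      f (p.1.cons p.2 p.2.2).oriented ^ 2 := by
  have h := f.summable_sq
  simp only [weight_top, one_mul] at h
  exact (consEquiv X.toCellComplex d).summable_iff.2 h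

theorem L2Form.tsum_sigma (f : X.L2Form (d + 1)) :
    ∑' s : X.OrderedCell d, ∑' v : {v // X.Link s.cell v}, f (s.cons v v.2).oriented ^ 2
      = ((d + 1).factorial : ℝ) * ‖f‖ ^ 2 := by
  rw [← f.summable_sigma.tsum_sigma, L2Form.norm_sq_eq]
  simp only [weight_top, one_mul]
  rw [← (consEquiv X.toCellComplex d).tsum_eq, ← mul_assoc, mul_one_div_cancel (by positivity),
    one_mul]
  rfl

/-- The boundary operator `∂_d` on square-summable `d`-forms. -/
noncomputable def boundaryForm (f : X.L2Form (d + 1)) : X.L2Form d :=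
  L2Form.mk (Quotient.lift (boundaryAt f) (by
      rintro s t ⟨π, h, rfl⟩
      simp [boundaryAt_perm f.isForm, h]))
    (by
      intro h2 σ
      induction σ using Quotient.inductionOn with
      | h s =>
        show boundaryAt f (s.perm (flipPerm d)) = - boundaryAt f s
        rw [boundaryAt_perm f.isForm, sign_flipPerm h2]; simp)
    (by
      exact Summable.of_nonneg_of_le
        (fun s => mul_nonneg (X.weight_pos s).le (sq_nonneg _))
        (fun s => weight_mul_boundaryAt_sq_le f s) f.summable_sigma.sigma)

theorem boundaryForm_apply (f : X.L2Form (d + 1)) (s : X.OrderedCell d) :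
    boundaryForm f s.oriented = boundaryAt f s := rfl

theorem norm_boundaryForm_sq_le (f : X.L2Form (d + 1)) :
    ‖boundaryForm f‖ ^ 2 ≤ ((d : ℝ) + 1) * ‖f‖ ^ 2 := by
  rw [L2Form.norm_sq_eq]
  have h := (boundaryForm f).summable_sq.tsum_le_tsum
    (fun s => weight_mul_boundaryAt_sq_le f s) f.summable_sigma.sigma
  rw [f.tsum_sigma] at h
  calc _ ≤ 1 / (d.factorial : ℝ) * (((d + 1).factorial : ℝ) * ‖f‖ ^ 2) := by
        exact mul_le_mul_of_nonneg_left h (by positivity)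
    _ = _ := by
        rw [Nat.factorial_succ]; push_cast; field_simp

variable (X)

/-- The boundary operator `∂_d : Ω_{L²}^d → Ω_{L²}^{d-1}`, `(∂_d f)(σ) = ∑_{v ◁ σ} f(vσ)`,
as a bounded operator. -/
noncomputable def boundary : X.L2Form (d + 1) →L[ℝ] X.L2Form d :=
  LinearMap.mkContinuous
    { toFun := boundaryForm
      map_add' := fun f g => by
        refine L2Form.ext fun s => ?_
        have := finite_link_cell s
        show boundaryAt (f + g) s = boundaryAt f s + boundaryAt g s
        exact Summable.tsum_add (Summable.of_finite) (Summable.of_finite)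
      map_smul' := fun c f => by
        refine L2Form.ext fun s => ?_
        show boundaryAt (c • f) s = c * boundaryAt f s
        exact tsum_mul_left } (√((d : ℝ) + 1)) (fun f => by
    rw [← sq_le_sq₀ (norm_nonneg _) (by positivity), mul_pow, Real.sq_sqrt (by positivity)]
    exact norm_boundaryForm_sq_le f)

theorem boundary_apply (f : X.L2Form (d + 1)) (s : X.OrderedCell d) :
    X.boundary f s.oriented = ∑' v : {v // X.Link s.cell v}, f (s.cons v v.2).oriented := rfl

/-- The upper Laplacian `Δ⁺ = ∂_d ∂_d^*` on `Ω_{L²}^{d-1}`. -/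
noncomputable def upperLaplacian : X.L2Form d →L[ℝ] X.L2Form d :=
  X.boundary ∘L (ContinuousLinearMap.adjoint X.boundary)

/-- The coboundary `(δg)(σ) = w(σ)⁻¹ ∑_i (-1)^i w(σ \ σ_i) g(σ \ σ_i)`, in terms of an ordering
`σ_0, …, σ_n` of the cell `σ`. -/
noncomputable def coboundaryAt {n : ℕ} (g : X.OrientedCell n → ℝ) (s : X.OrderedCell (n + 1)) : ℝ :=
  (X.weight s.cell)⁻¹ *
    ∑ i : Fin (n + 1), (-1) ^ (i : ℕ) * X.weight (s.face i).cell * g (s.face i).oriented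

/-! From here on the dimension is `d = k + 1 ≥ 1`, so that `(d-2)`-cells have `k` vertices,
`(d-1)`-cells have `k + 1` vertices and `d`-cells have `k + 2` vertices. -/

section Positive

variable {k : ℕ} (Y : BoundedComplex V (k + 1))

/-- The `L²`-coboundaries `B^{d-1} = im δ_{d-1} ∩ Ω_{L²}^{d-1}`, where the domain of `δ_{d-1}` is
`Ω_{L²}^{d-2}`. -/
def exactForms : Submodule ℝ (Y.L2Form (k + 1)) where
  carrier := {f | ∃ g : Y.L2Form k, ∀ s : Y.OrderedCell (k + 1),
    f s.oriented = Y.coboundaryAt g s}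
  zero_mem' := ⟨0, fun s => by simp [coboundaryAt]⟩
  add_mem' := by
    rintro f f' ⟨g, hg⟩ ⟨g', hg'⟩
    refine ⟨g + g', fun s => ?_⟩
    rw [L2Form.add_apply, hg, hg', coboundaryAt, coboundaryAt, coboundaryAt, ← mul_add,
      ← Finset.sum_add_distrib]
    simp only [L2Form.add_apply, mul_add]
  smul_mem' := by
    rintro c f ⟨g, hg⟩
    refine ⟨c • g, fun s => ?_⟩
    rw [L2Form.smul_apply, hg, coboundaryAt, coboundaryAt, mul_left_comm, Finset.mul_sum]
    simp only [L2Form.smul_apply, mul_left_comm]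

/-- The `(d-1)`-cycles `Z_{d-1} = (B^{d-1})^⊥`, the orthogonal complement in `Ω_{L²}^{d-1}`. -/
noncomputable def cycles : Submodule ℝ (Y.L2Form (k + 1)) := Y.exactFormsᗮ

variable {Y}

theorem alternating_sum_eq_zero {n : ℕ} (H : Equiv.Perm (Fin n) → ℝ) (a b : Fin n) (hab : a ≠ b)
    (hH : ∀ π, H (π * Equiv.swap a b) = H π) :
    ∑ π : Equiv.Perm (Fin n), ((Equiv.Perm.sign π : ℤ) : ℝ) * H π = 0 := by
  have h := Equiv.sum_comp (Equiv.mulRight (Equiv.swap a b))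
    (fun π : Equiv.Perm (Fin n) => ((Equiv.Perm.sign π : ℤ) : ℝ) * H π)
  simp only [Equiv.coe_mulRight, hH, Equiv.Perm.sign_mul, Equiv.Perm.sign_swap hab] at h
  simp only [mul_neg, mul_one, Units.val_neg, Int.cast_neg, neg_mul, Finset.sum_neg_distrib] at h
  linarith

/-- `δ_d δ_{d-1} = 0`. -/
theorem alternating_faces (g : Y.OrientedCell k → ℝ) (t : Y.OrderedCell (k + 1 + 1)) :
    ∑ π : Equiv.Perm (Fin (k + 1 + 1)), ((Equiv.Perm.sign π : ℤ) : ℝ) *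
      ∑ j : Fin (k + 1), (-1) ^ (j : ℕ) * g ((((t.perm π).face 0).face j).oriented) = 0 := by
  simp only [Finset.mul_sum]
  rw [Finset.sum_comm]
  refine Finset.sum_eq_zero fun j _ => ?_
  refine alternating_sum_eq_zero _ 0 j.succ (Fin.succ_ne_zero j).symm fun π => ?_
  congr 3
  ext i
  show t.vert ((π * Equiv.swap 0 j.succ) ((0 : Fin (k + 1 + 1)).succAbove (j.succAbove i)))
    = t.vert (π ((0 : Fin (k + 1 + 1)).succAbove (j.succAbove i)))
  rw [Equiv.Perm.mul_apply, Equiv.swap_apply_of_ne_of_ne]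
  · exact Fin.succAbove_ne _ _
  · rw [Fin.succAbove_zero]
    exact fun h => Fin.succAbove_ne _ _ (Fin.succ_injective _ h)

theorem inner_boundary_exact (f : Y.L2Form (k + 1 + 1)) (b : Y.L2Form (k + 1))
    (hb : b ∈ Y.exactForms) : inner ℝ (Y.boundary f) b = 0 := by
  obtain ⟨g, hg⟩ := hb
  have hw : ∀ s : Y.OrderedCell k, Y.weight s.cell = 1 := fun s =>
    if_neg (by rw [card_cell]; omega)
  set u : Y.OrderedCell (k + 1) → ℝ := fun s => Y.weight s.cell * b s.oriented with hu
  have hu' : ∀ s, u s = ∑ j : Fin (k + 1), (-1) ^ (j : ℕ) * g (s.face j).oriented := by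
    intro s
    rw [hu]
    simp only [hg, coboundaryAt, hw, mul_one]
    rw [mul_inv_cancel_left₀ (Y.weight_pos s).ne']
  -- summability over all ordered `d`-cells
  have hs1 : Summable fun p : Σ s : Y.OrderedCell (k + 1), {v // Y.Link s.cell v} => u p.1 ^ 2 := by
    have e : ∀ s : Y.OrderedCell (k + 1), ∑' _ : {v // Y.Link s.cell v}, u s ^ 2
        = Y.weight s.cell * b s.oriented ^ 2 := by
      intro s
      rw [← sum_link_const s (Y.weight s.cell * b s.oriented ^ 2)]
      refine tsum_congr fun v => ?_
      rw [hu]; ring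
    refine (summable_sigma_of_nonneg (fun p => sq_nonneg _)).2 ⟨fun s => ?_, ?_⟩
    · have := finite_link_cell s
      exact Summable.of_finite
    · simp only [e]
      exact b.summable_sq
  have hs2 : Summable fun p : Σ s : Y.OrderedCell (k + 1), {v // Y.Link s.cell v} =>
      f (p.1.cons p.2 p.2.2).oriented * u p.1 := by
    refine Summable.of_norm_bounded (f.summable_sigma.add hs1) fun p => ?_
    rw [Real.norm_eq_abs, abs_le]
    constructor <;> nlinarith [sq_nonneg (f (p.1.cons p.2 p.2.2).oriented - u p.1),
      sq_nonneg (f (p.1.cons p.2 p.2.2).oriented + u p.1),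
      sq_nonneg (f (p.1.cons p.2 p.2.2).oriented), sq_nonneg (u p.1)]
  set F : Y.OrderedCell (k + 1 + 1) → ℝ := fun t => f t.oriented * u (t.face 0) with hF
  have hFe : ∀ p : Σ s : Y.OrderedCell (k + 1), {v // Y.Link s.cell v},
      F (consEquiv Y.toCellComplex (k + 1) p) = f (p.1.cons p.2 p.2.2).oriented * u p.1 :=
    fun p => rfl
  have hsF : Summable F := by
    rw [← (consEquiv Y.toCellComplex (k + 1)).summable_iff]
    exact hs2
  have h1 : inner ℝ (Y.boundary f) b = (1 / ((k + 1).factorial : ℝ)) * ∑' t, F t := by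
    rw [L2Form.inner_eq, ← (consEquiv Y.toCellComplex (k + 1)).tsum_eq F]
    simp only [hFe]
    rw [hs2.tsum_sigma]
    congr 1
    refine tsum_congr fun s => ?_
    show _ = ∑' v : {v // Y.Link s.cell v}, f (s.cons v v.2).oriented * u s
    rw [tsum_mul_right, boundary_apply, hu]
    ring
  have h2 : ∑ π : Equiv.Perm (Fin (k + 1 + 1)), ∑' t : Y.OrderedCell (k + 1 + 1), F (t.perm π) = 0 := by
    have hperm : ∀ π : Equiv.Perm (Fin (k + 1 + 1)),
        Summable fun t : Y.OrderedCell (k + 1 + 1) => F (t.perm π) := fun π => by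
      let e : Y.OrderedCell (k + 1 + 1) ≃ Y.OrderedCell (k + 1 + 1) :=
        ⟨fun t => t.perm π, fun t => t.perm π⁻¹,
          fun t => by simp [OrderedCell.perm_perm, OrderedCell.perm_one],
          fun t => by simp [OrderedCell.perm_perm, OrderedCell.perm_one]⟩
      exact e.summable_iff.2 hsF
    rw [← Summable.tsum_finsetSum fun π _ => hperm π]
    convert tsum_zero with t
    have := alternating_faces (Y := Y) g t
    simp only [← hu'] at this
    simp only [hF, f.isForm.perm]
    rw [← mul_zero (f t.oriented), ← this, Finset.mul_sum]
    exact Finset.sum_congr rfl fun π _ => by ring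
  have h3 : ∀ π : Equiv.Perm (Fin (k + 1 + 1)), ∑' t : Y.OrderedCell (k + 1 + 1), F (t.perm π) = ∑' t, F t := fun π => by
    let e : Y.OrderedCell (k + 1 + 1) ≃ Y.OrderedCell (k + 1 + 1) :=
      ⟨fun t => t.perm π, fun t => t.perm π⁻¹,
        fun t => by simp [OrderedCell.perm_perm, OrderedCell.perm_one],
        fun t => by simp [OrderedCell.perm_perm, OrderedCell.perm_one]⟩
    exact e.tsum_eq F
  simp only [h3, Finset.sum_const, Finset.card_univ, nsmul_eq_mul] at h2
  rcases mul_eq_zero.1 h2 with h | h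
  · exact absurd h (by exact_mod_cast Fintype.card_ne_zero)
  · rw [h1, h, mul_zero]

/-- `Δ⁺` maps `Z_{d-1}` into itself. -/
theorem upperLaplacian_mem_cycles (z : Y.L2Form (k + 1)) (_ : z ∈ Y.cycles) :
    Y.upperLaplacian z ∈ Y.cycles := by
  rw [cycles, Submodule.mem_orthogonal']
  intro b hb
  exact inner_boundary_exact _ b hb

variable (Y)

/-- The restriction `Δ⁺|_{Z_{d-1}}`. -/
noncomputable def cycleLaplacian : Y.cycles →L[ℝ] Y.cycles :=
  Y.upperLaplacian.restrict upperLaplacian_mem_cycles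

end Positive

/-! The `p`-lazy `(d-1)`-walk and the expectation process. -/

section Walk

open Classical in
/-- The one-step transition probability from `σ` to `σ'` of the `p`-lazy `(d-1)`-walk on the
oriented `(d-1)`-cells. -/
noncomputable def transition (p : ℝ) (σ σ' : X.OrientedCell d) : ℝ :=
  if σ' = σ then p
  else if σ.Neighbor σ' then (1 - p) / (d * X.deg σ.cell)
  else 0

open Classical in
/-- `𝐩_n^{σ₀}(σ)`: the probability that the `p`-lazy walk started at `σ₀` is at `σ` at time `n`.
(Only finitely many terms of the sum are nonzero.) -/
noncomputable def walkProb (p : ℝ) (σ₀ : X.OrientedCell d) : ℕ → X.OrientedCell d → ℝ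
  | 0, σ => if σ = σ₀ then 1 else 0
  | n + 1, σ => ∑' σ' : X.OrientedCell d, walkProb p σ₀ n σ' * X.transition p σ' σ

/-- The expectation process: `ℰ_n^{σ₀}(σ) = 𝐩_n^{σ₀}(σ) - 𝐩_n^{σ₀}(σ̄)` for `d ≥ 2`, and
`ℰ_n^{σ₀} = 𝐩_n^{σ₀}` for graphs. -/
noncomputable def expectation (p : ℝ) (σ₀ : X.OrientedCell d) (n : ℕ) (σ : X.OrientedCell d) : ℝ :=
  if 2 ≤ d then X.walkProb p σ₀ n σ - X.walkProb p σ₀ n σ.flip else X.walkProb p σ₀ n σ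

/-- The normalized expectation process. -/
noncomputable def normalizedExpectation (p : ℝ) (σ₀ : X.OrientedCell d) (n : ℕ)
    (σ : X.OrientedCell d) : ℝ :=
  ((d : ℝ) / (p * ((d : ℝ) - 1) + 1)) ^ n * X.expectation p σ₀ n σ

/-- Property (T) for the laziness `p`: `∑_n ℰ̃_n^σ(σ) < ∞` for every `(d-1)`-cell `σ`. -/
def PropTAt (p : ℝ) : Prop :=
  ∀ σ : X.OrientedCell d, Summable fun n : ℕ => X.normalizedExpectation p σ n σ

/-- Property (T): the condition holds for some laziness `1/2 ≤ p < 1`. -/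
def PropT : Prop := ∃ p : ℝ, 1 / 2 ≤ p ∧ p < 1 ∧ X.PropTAt p

/-- Property (T'): every `𝟙_σ`, for `σ` a `(d-1)`-cell, is the boundary of an `L²` `d`-form. -/
def PropT' : Prop :=
  ∀ σ : X.OrientedCell d, ∃ f : X.L2Form (d + 1), ∀ σ' : X.OrientedCell d,
    X.boundary f σ' = σ.dirac σ'

/-- Property (A'): `min Spec Δ⁺ = 0`. -/
def PropA' : Prop := IsLeast (spectrum ℝ X.upperLaplacian) 0

/-- Property (S): all `(d-2)`-cells (they have `d - 1` elements) have infinite degree. -/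
def PropS : Prop := ∀ c ∈ X.cells, c.card + 1 = d → X.degree c = ⊤

/-- Property (A): `λ(X) = min Spec (Δ⁺|_{Z_{d-1}}) = 0`, for `d = k + 1`. -/
def PropA {k : ℕ} (Y : BoundedComplex V (k + 1)) : Prop :=
  IsLeast (spectrum ℝ Y.cycleLaplacian) 0

end Walk

end BoundedComplex

/-! Everything is read off from the positive operator `Δ⁺ = ∂∂*`. Spectra of positive operators lie
in `[0, ∞)`, so (A') says that `Δ⁺` is not invertible and (A) says that its restriction to `Z = B^⊥`
is not invertible. Since `∂∘∂ = 0` in the dual form of `inner_boundary_exact`, `B` lies in the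
kernel of `∂*`. If `Δ⁺` is invertible, then `B = 0`, `Z` is the whole space and the restriction is
`Δ⁺` itself; this gives (A) ⇒ (A'). If (S) holds, then again `B = 0` (`PropS.exactForms_eq_bot`),
and (A) and (A') coincide.

If `Δ⁺` is invertible, `∂*(Δ⁺)⁻¹𝟙_σ` is a preimage of `𝟙_σ` under `∂`, which is (T'). Under (T')
every `𝟙_σ` is a boundary, hence orthogonal to `B`, so `B = 0`; a `(d-2)`-cell of finite degree
would put the nonzero form `δ𝟙_c` into `B`, so (S) holds.

For the walk, one step acts on forms as an affine function of `Δ⁺`, and after normalization the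
expectation process is `(1 - cΔ⁺)ⁿ 𝟙_σ` with `c = (1-p)/(pk+1)`, `k = d-1`
(`normalizedExpectation_eq`). For `p ≥ 1/2` one has `cΔ⁺ ≤ 1`, and then the series in (T_p)
converges exactly when `⟨𝟙_σ, y⟩² ≤ C⟨Δ⁺y, y⟩` for some `C` and all `y` (`summable_inner_pow_iff`).
This criterion does not mention `p`, follows from (T') by Cauchy–Schwarz, and forces `Δ⁺` to be
injective. An injective positive operator whose spectrum avoids a punctured neighborhood of `0` is
invertible (`isUnit_of_injective_of_gap`), so `0` cannot be an isolated spectral point when (T)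
holds. -/

section PositiveOperators

variable {E : Type*} [NormedAddCommGroup E] [InnerProductSpace ℝ E]

/-! ### Positive operators: spectral gap, invertibility, and sums of powers. -/

namespace ContinuousLinearMap.IsPositive

/-- Cauchy–Schwarz for the form `⟨T x, y⟩` of a positive operator. -/
theorem inner_sq_le {T : E →L[ℝ] E} (hT : T.IsPositive) (x y : E) :
    inner ℝ (T x) y ^ 2 ≤ inner ℝ (T x) x * inner ℝ (T y) y := by
  have hsymm : inner ℝ (T y) x = inner ℝ (T x) y := by
    rw [hT.inner_left_eq_inner_right, real_inner_comm]
  have key : ∀ t : ℝ, 0 ≤ inner ℝ (T y) y * (t * t) + 2 * inner ℝ (T x) y * t + inner ℝ (T x) x := by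
    intro t
    have := hT.inner_nonneg_left (x + t • y)
    simp only [map_add, map_smul, inner_add_left, inner_add_right, inner_smul_left,
      inner_smul_right, conj_trivial, hsymm] at this
    linarith
  have := discrim_le_zero key
  rw [discrim] at this
  nlinarith

theorem spectrum_nonneg [CompleteSpace E] {T : E →L[ℝ] E} (hT : T.IsPositive) {r : ℝ}
    (hr : r ∈ spectrum ℝ T) : 0 ≤ r :=
  (SpectrumRestricts.nnreal_iff.1 hT.spectrumRestricts) r hr

theorem zero_isLeast_spectrum_iff [CompleteSpace E] {T : E →L[ℝ] E} (hT : T.IsPositive) :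
    IsLeast (spectrum ℝ T) 0 ↔ ¬ IsUnit T := by
  rw [← spectrum.zero_mem_iff ℝ]
  exact ⟨fun h => h.1, fun h => ⟨h, fun _ hr => hT.spectrum_nonneg hr⟩⟩

/-- If the spectrum of a positive operator does not meet `(0, ε)`, then `c ⟨T x, x⟩ ≤ ‖T x‖²` for
some `c > 0`. -/
theorem exists_mul_inner_le_norm_sq [CompleteSpace E] {T : E →L[ℝ] E} (hT : T.IsPositive)
    {ε : ℝ} (hε : 0 < ε) (hs : ∀ r ∈ spectrum ℝ T, |r| < ε → r = 0) :
    ∃ c > 0, ∀ x, c * inner ℝ (T x) x ≤ ‖T x‖ ^ 2 := by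
  -- The point `l = ε/3` lies in the gap at distance at least `l` from the spectrum: `l` from `0`,
  -- and `ε - l = 2l` from the rest of it. As norm and spectral radius agree for self-adjoint
  -- operators, `‖(l - T)⁻¹‖ ≤ 1/l`.
  have hl : 0 < ε / 3 := by positivity
  set l := ε / 3 with hldef
  have hu : IsUnit (algebraMap ℝ (E →L[ℝ] E) l - T) := by
    rw [← spectrum.notMem_iff]
    intro h
    exact hl.ne' (hs l h (by rw [abs_of_pos hl]; linarith))
  obtain ⟨a, ha⟩ := hu
  set B : E →L[ℝ] E := ↑a⁻¹ with hB
  have haself : IsSelfAdjoint (a : E →L[ℝ] E) := by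
    rw [ha]
    exact (IsSelfAdjoint.algebraMap _ (IsSelfAdjoint.all l)).sub hT.isSelfAdjoint
  have hBself : IsSelfAdjoint B := by
    have : IsSelfAdjoint a := Units.ext haself
    exact congrArg Units.val this.inv
  have hnorm : ‖B‖ ≤ l⁻¹ := by
    have h1 : spectralRadius ℝ B ≤ ENNReal.ofReal l⁻¹ := by
      refine iSup₂_le fun r hr => ?_
      have hr' := spectrum.inv₀_mem_iff.2 hr
      have hr' : l - r⁻¹ ∈ spectrum ℝ T := by
        rw [ha, ← spectrum.singleton_sub_eq] at hr'
        obtain ⟨_, rfl, t, ht, h⟩ := hr'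
        rwa [← h, sub_sub_cancel]
      have hl' : l ≤ |r⁻¹| := by
        by_cases h : |l - r⁻¹| < ε
        · have := hs _ hr' h
          rw [← sub_eq_zero.1 this]
          exact le_abs_self l
        · have := abs_sub l r⁻¹
          rw [abs_of_pos hl] at this
          linarith
      rw [abs_inv] at hl'
      rw [← enorm_eq_nnnorm, ← ofReal_norm, Real.norm_eq_abs]
      exact ENNReal.ofReal_le_ofReal ((le_inv_comm₀ hl (inv_pos.1 (hl.trans_le hl'))).1 hl')
    rw [ContinuousLinearMap.spectralRadius_eq_nnnorm B hBself, ← enorm_eq_nnnorm,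
      ← ofReal_norm] at h1
    exact (ENNReal.ofReal_le_ofReal_iff (by positivity)).1 h1
  -- Squaring `l‖x‖ ≤ ‖lx - Tx‖` and cancelling `l²‖x‖²` leaves `2l⟨Tx, x⟩ ≤ ‖Tx‖²`.
  refine ⟨2 * l, by positivity, fun x => ?_⟩
  have h1 : ‖x‖ ≤ l⁻¹ * ‖l • x - T x‖ := by
    have hx : x = B (l • x - T x) := by
      have : (B * (a : E →L[ℝ] E)) x = x := by rw [hB, Units.inv_mul]; rfl
      rw [ha] at this
      simpa [Algebra.algebraMap_eq_smul_one] using this.symm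
    calc ‖x‖ = ‖B (l • x - T x)‖ := by rw [← hx]
      _ ≤ ‖B‖ * ‖l • x - T x‖ := B.le_opNorm _
      _ ≤ _ := by gcongr
  rw [inv_mul_eq_div, le_div_iff₀ hl] at h1
  have h2 : (‖x‖ * l) ^ 2 ≤ ‖l • x - T x‖ ^ 2 := by gcongr
  rw [norm_sub_sq_real, norm_smul, Real.norm_eq_abs, abs_of_pos hl, inner_smul_left,
    conj_trivial, real_inner_comm] at h2
  nlinarith

/-- The gap inequality for `T²` reads `c‖Tx‖² ≤ ‖T(Tx)‖²`, so `T` is bounded below on its range.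
Injectivity and self-adjointness make the range dense, hence `T` is bounded below everywhere and
`T²` is coercive. Passing to `T²` avoids the square root of `T`. -/
theorem isUnit_of_injective_of_gap [CompleteSpace E] {T : E →L[ℝ] E} (hT : T.IsPositive)
    (hinj : ∀ x, T x = 0 → x = 0)
    {ε : ℝ} (hε : 0 < ε) (hs : ∀ r ∈ spectrum ℝ T, |r| < ε → r = 0) : IsUnit T := by
  have hself : ∀ x y, inner ℝ (T x) y = inner ℝ x (T y) := hT.inner_left_eq_inner_right
  have hTT : (T * T).IsPositive := by
    refine (ContinuousLinearMap.isPositive_iff _).2 ⟨fun x y => ?_, fun x => ?_⟩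
    · show inner ℝ (T (T x)) y = inner ℝ x (T (T y))
      rw [hself, hself]
    · show 0 ≤ inner ℝ (T (T x)) x
      rw [hself]; exact real_inner_self_nonneg
  obtain ⟨c, hc, h⟩ := hTT.exists_mul_inner_le_norm_sq (ε := ε ^ 2) (by positivity) (by
    intro r hr hrε
    by_contra hr0
    have hrpos : 0 < r := lt_of_le_of_ne (hTT.spectrum_nonneg hr) (Ne.symm hr0)
    rw [abs_of_pos hrpos] at hrε
    have hsq : √r < ε := by
      rw [Real.sqrt_lt' hε]; exact hrε
    have hsqpos : 0 < √r := Real.sqrt_pos.2 hrpos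
    refine hr ?_
    -- Spectral mapping by hand: in `r - T² = (√r - T)(√r + T)` the first factor is invertible
    -- because `0 < √r < ε`, the second because `-√r < 0`.
    have e : algebraMap ℝ (E →L[ℝ] E) r - T * T
        = (algebraMap ℝ (E →L[ℝ] E) (√r) - T) * (algebraMap ℝ (E →L[ℝ] E) (√r) + T) := by
      have hcomm := Algebra.commutes (√r) T
      have hrr : algebraMap ℝ (E →L[ℝ] E) r
          = algebraMap ℝ (E →L[ℝ] E) (√r) * algebraMap ℝ (E →L[ℝ] E) (√r) := by
        rw [← map_mul, Real.mul_self_sqrt hrpos.le]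
      rw [hrr, sub_mul, mul_add, mul_add, hcomm]
      abel
    show IsUnit _
    rw [e]
    refine IsUnit.mul ?_ ?_
    · rw [← spectrum.notMem_iff]
      intro hh
      exact hsqpos.ne' (hs _ hh (by rwa [abs_of_pos hsqpos]))
    · have : IsUnit (algebraMap ℝ (E →L[ℝ] E) (-√r) - T) := by
        rw [← spectrum.notMem_iff]
        intro hh
        linarith [hT.spectrum_nonneg hh]
      rw [map_neg] at this
      have := this.neg
      rwa [neg_sub, sub_neg_eq_add, add_comm] at this)
  have hrange : ∀ z ∈ closure (Set.range T), c * ‖z‖ ^ 2 ≤ ‖T z‖ ^ 2 := by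
    have hcl : IsClosed {z : E | c * ‖z‖ ^ 2 ≤ ‖T z‖ ^ 2} :=
      isClosed_le (by fun_prop) (by fun_prop)
    refine fun z hz => closure_minimal ?_ hcl hz
    rintro _ ⟨x, rfl⟩
    have := h x
    change c * inner ℝ (T (T x)) x ≤ ‖T (T x)‖ ^ 2 at this
    rw [hself, real_inner_self_eq_norm_sq] at this
    exact this
  have hdense : ∀ z, z ∈ closure (Set.range T) := by
    have : T.rangeᗮ = ⊥ := by
      rw [ContinuousLinearMap.orthogonal_range, hT.isSelfAdjoint.adjoint_eq]
      exact LinearMap.ker_eq_bot'.2 hinj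
    have h2 := (Submodule.topologicalClosure_eq_top_iff).2 this
    intro z
    have : z ∈ T.range.topologicalClosure := h2 ▸ Submodule.mem_top
    exact this
  have hu : IsUnit (T * T) := by
    refine ContinuousLinearMap.isUnit_of_forall_le_norm_inner_map _ (c := ⟨c, hc.le⟩) hc fun x => ?_
    show ‖x‖ ^ 2 * c ≤ ‖inner ℝ (T (T x)) x‖
    rw [hself, real_inner_self_eq_norm_sq, Real.norm_of_nonneg (sq_nonneg _), mul_comm]
    exact hrange x (hdense x)
  rw [← sq] at hu
  exact (isUnit_pow_iff two_ne_zero).1 hu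

/-- For a positive operator `T` and `0 < c` with `cT ≤ 1`, the series `∑ ⟨(1 - cT)ⁿ x, x⟩` converges
if and only if `⟨x, y⟩² ≤ C ⟨T y, y⟩` for some `C` and all `y` (i.e. `x` is in the range of the
square root of `T`). -/
theorem summable_inner_pow_iff {T : E →L[ℝ] E} (hT : T.IsPositive) {c : ℝ} (hc : 0 < c)
    (hle : ∀ y, c * inner ℝ (T y) y ≤ ‖y‖ ^ 2) (x : E) :
    Summable (fun n : ℕ => inner ℝ (((1 - c • T : E →L[ℝ] E) ^ n) x) x) ↔
      ∃ C : ℝ, ∀ y, inner ℝ x y ^ 2 ≤ C * inner ℝ (T y) y := by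
  set A : E →L[ℝ] E := 1 - c • T with hA
  have hApos : A.IsPositive := by
    refine (ContinuousLinearMap.isPositive_iff _).2 ⟨fun y z => ?_, fun y => ?_⟩
    · show inner ℝ (y - c • T y) z = inner ℝ y (z - c • T z)
      rw [inner_sub_left, inner_sub_right, inner_smul_left, inner_smul_right,
        hT.inner_left_eq_inner_right, conj_trivial]
    · show 0 ≤ inner ℝ (y - c • T y) y
      rw [inner_sub_left, inner_smul_left, real_inner_self_eq_norm_sq, conj_trivial]
      linarith [hle y]
  have hsym : ∀ (m : ℕ) (y z : E), inner ℝ ((A ^ m) y) z = inner ℝ y ((A ^ m) z) := by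
    intro m
    induction m with
    | zero => intro y z; rfl
    | succ m ih =>
      intro y z
      rw [pow_succ]
      show inner ℝ ((A ^ m) (A y)) z = inner ℝ y ((A ^ m * A) z)
      rw [ih, hApos.inner_left_eq_inner_right, ← pow_succ, pow_succ']
      rfl
  have hadd : ∀ (m n : ℕ) (y : E), (A ^ (m + n)) y = (A ^ m) ((A ^ n) y) := fun m n y => by
    rw [pow_add]; rfl
  have hnonneg : ∀ n y, 0 ≤ inner ℝ ((A ^ n) y) y := by
    intro n y
    rcases Nat.even_or_odd' n with ⟨m, rfl | rfl⟩
    · rw [two_mul, hadd, hsym]; exact real_inner_self_nonneg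
    · rw [show 2 * m + 1 = m + (1 + m) by ring, hadd, hsym, hadd, pow_one]
      exact hApos.inner_nonneg_left _
  set S : ℕ → E := fun N => ∑ n ∈ Finset.range N, (A ^ n) x with hS
  -- With `A = 1 - cT` the partial sums `S N` telescope under `cT`, so they act as approximate
  -- solutions of `cTS = x`.
  have htel : ∀ N, c • T (S N) = x - (A ^ N) x := by
    intro N
    induction N with
    | zero => simp [hS]
    | succ N ih =>
      simp only [hS, Finset.sum_range_succ, map_add, smul_add] at ih ⊢
      rw [ih, pow_succ']
      show _ = x - ((A ^ N) x - c • T ((A ^ N) x))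
      abel
  have hSx : ∀ N, inner ℝ x (S N) = ∑ n ∈ Finset.range N, inner ℝ ((A ^ n) x) x := by
    intro N
    rw [hS, inner_sum]
    exact Finset.sum_congr rfl fun n _ => real_inner_comm _ _
  -- The discarded term `⟨A^N x, S N⟩` is a sum of numbers `⟨A^(n+N) x, x⟩ ≥ 0`.
  have hform : ∀ N, c * inner ℝ (T (S N)) (S N) ≤ inner ℝ x (S N) := by
    intro N
    have h0 : 0 ≤ inner ℝ ((A ^ N) x) (S N) := by
      rw [hS, inner_sum]
      refine Finset.sum_nonneg fun n _ => ?_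
      rw [← hsym, ← hadd]
      exact hnonneg _ _
    have := congrArg (fun z => inner ℝ z (S N)) (htel N)
    simp only [inner_smul_left, inner_sub_left, conj_trivial] at this
    linarith
  constructor
  · intro hsum
    set M := ∑' n : ℕ, inner ℝ ((A ^ n) x) x with hM
    have hSM : ∀ N, inner ℝ x (S N) ≤ M := fun N => by
      rw [hSx]; exact hsum.sum_le_tsum _ fun n _ => hnonneg n x
    -- `‖A^N x‖²` is the term with index `2N` of the convergent series.
    have hlim : Filter.Tendsto (fun N => (A ^ N) x) Filter.atTop (nhds 0) := by
      have h2 : Filter.Tendsto (fun N : ℕ => inner ℝ ((A ^ (2 * N)) x) x) Filter.atTop (nhds 0) :=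
        hsum.tendsto_atTop_zero.comp (Filter.tendsto_id.const_mul_atTop' two_pos)
      have h3 : Filter.Tendsto (fun N : ℕ => ‖(A ^ N) x‖ ^ 2) Filter.atTop (nhds 0) := by
        refine h2.congr fun N => ?_
        rw [two_mul, hadd, hsym, real_inner_self_eq_norm_sq]
      have h4 := h3.sqrt
      simp only [Real.sqrt_sq (norm_nonneg _), Real.sqrt_zero] at h4
      exact tendsto_zero_iff_norm_tendsto_zero.2 h4
    refine ⟨c * M, fun y => ?_⟩
    -- Cauchy–Schwarz for the form of `T` at `S N` and `y`; the bound is uniform in `N`, so it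
    -- survives the limit `A^N x → 0`.
    have hb : ∀ N, (inner ℝ (x - (A ^ N) x) y) ^ 2 ≤ c * M * inner ℝ (T y) y := by
      intro N
      have hy := hT.inner_nonneg_left y
      calc (inner ℝ (x - (A ^ N) x) y) ^ 2 = c ^ 2 * inner ℝ (T (S N)) y ^ 2 := by
            rw [← htel, inner_smul_left, conj_trivial, mul_pow]
        _ ≤ c ^ 2 * (inner ℝ (T (S N)) (S N) * inner ℝ (T y) y) := by
            gcongr; exact hT.inner_sq_le _ _
        _ = c * ((c * inner ℝ (T (S N)) (S N)) * inner ℝ (T y) y) := by ring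
        _ ≤ c * (M * inner ℝ (T y) y) := by
            gcongr; exact (hform N).trans (hSM N)
        _ = _ := by ring
    have hl : Filter.Tendsto (fun N => (inner ℝ (x - (A ^ N) x) y) ^ 2) Filter.atTop
        (nhds ((inner ℝ (x - 0) y) ^ 2)) :=
      ((tendsto_const_nhds.sub hlim).inner tendsto_const_nhds).pow 2
    rw [sub_zero] at hl
    exact le_of_tendsto' hl hb
  · rintro ⟨C, hC⟩
    refine summable_of_sum_range_le (c := |C| / c) (fun n => hnonneg n x) fun N => ?_
    rw [← hSx]
    -- The hypothesis is tested on `y = S N`: with `s = ⟨x, S N⟩` it gives `s² ≤ |C| s / c`, and a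
    -- positive `s` can be cancelled.
    have h0 : 0 ≤ inner ℝ x (S N) := by
      rw [hSx]; exact Finset.sum_nonneg fun n _ => hnonneg n x
    rcases h0.eq_or_lt with h | h
    · rw [← h]; positivity
    have hTS := hT.inner_nonneg_left (S N)
    have h1 : inner ℝ x (S N) ^ 2 ≤ |C| * inner ℝ (T (S N)) (S N) :=
      (hC _).trans (mul_le_mul_of_nonneg_right (le_abs_self C) hTS)
    rw [le_div_iff₀ hc]
    have h2 : |C| * (c * inner ℝ (T (S N)) (S N)) ≤ |C| * inner ℝ x (S N) :=
      mul_le_mul_of_nonneg_left (hform N) (abs_nonneg C)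
    refine le_of_mul_le_mul_right ?_ h
    nlinarith

end ContinuousLinearMap.IsPositive

end PositiveOperators

/-! ### Orderings, orientations, faces and neighbors. -/

namespace CellComplex

variable {V : Type*} {X : CellComplex V} {n : ℕ}

theorem exists_eq_decomposeFin_symm (κ : Equiv.Perm (Fin (n + 1))) (h : κ 0 = 0) :
    ∃ e : Equiv.Perm (Fin n), κ = Equiv.Perm.decomposeFin.symm (0, e) ∧
      Equiv.Perm.sign e = Equiv.Perm.sign κ := by
  obtain ⟨⟨p, e⟩, rfl⟩ := Equiv.Perm.decomposeFin.symm.surjective κ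
  rw [Equiv.Perm.decomposeFin_symm_apply_zero] at h
  subst h
  exact ⟨e, rfl, by rw [Equiv.Perm.decomposeFin.symm_sign]; simp⟩

theorem sign_flipPerm_pow (j : ℕ) (h : 2 ≤ n) :
    Equiv.Perm.sign (flipPerm n ^ j) = (-1) ^ j := by
  rw [map_pow, sign_flipPerm h]

theorem flipPerm_mul_self (n : ℕ) : flipPerm n * flipPerm n = 1 := by
  match n with
  | 0 => rfl
  | 1 => rfl
  | m + 2 => simp [flipPerm]

theorem perm_eq_one_of_lt_two (h : n < 2) (π : Equiv.Perm (Fin n)) : π = 1 := by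
  have : Subsingleton (Fin n) := Fin.subsingleton_iff_le_one.2 (by omega)
  exact Subsingleton.elim _ _

namespace OrderedCell

theorem perm_injective (s : X.OrderedCell n) : Function.Injective fun π => s.perm π := by
  intro π ρ h
  refine Equiv.ext fun i => s.vert.injective ?_
  exact congrFun (congrArg (fun t : X.OrderedCell n => (t.vert : Fin n → V)) h) i

theorem oriented_perm_of_sign_eq_one (s : X.OrderedCell n) {π : Equiv.Perm (Fin n)}
    (h : Equiv.Perm.sign π = 1) : (s.perm π).oriented = s.oriented :=
  (Quotient.sound ⟨π, h, rfl⟩ :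
    (Quotient.mk _ s : X.OrientedCell n) = Quotient.mk _ (s.perm π)).symm

theorem oriented_flip (s : X.OrderedCell n) : s.oriented.flip = (s.perm (flipPerm n)).oriented :=
  rfl

theorem iterate_flip_oriented (s : X.OrderedCell n) (j : ℕ) :
    OrientedCell.flip^[j] s.oriented = (s.perm (flipPerm n ^ j)).oriented := by
  induction j with
  | zero => rfl
  | succ j ih => rw [Function.iterate_succ_apply', ih, oriented_flip, perm_perm, pow_succ]

/-- The sign is constrained only for `2 ≤ n`, since smaller cells have a single ordering. -/
theorem oriented_perm (s : X.OrderedCell n) {π : Equiv.Perm (Fin n)} {j : ℕ}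
    (h : 2 ≤ n → Equiv.Perm.sign π = (-1) ^ j) :
    (s.perm π).oriented = OrientedCell.flip^[j] s.oriented := by
  rw [iterate_flip_oriented]
  by_cases hn : 2 ≤ n
  · rw [← oriented_perm_of_sign_eq_one (s.perm (flipPerm n ^ j)) (π := (flipPerm n ^ j)⁻¹ * π),
      perm_perm, mul_inv_cancel_left]
    rw [Equiv.Perm.sign_mul, Equiv.Perm.sign_inv, sign_flipPerm_pow j hn, h hn,
      ← mul_pow]
    simp
  · rw [perm_eq_one_of_lt_two (by omega) π, perm_eq_one_of_lt_two (by omega) (flipPerm n ^ j)]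

theorem eq_perm_of_oriented_eq {s t : X.OrderedCell n} {j : ℕ}
    (h : t.oriented = OrientedCell.flip^[j] s.oriented) :
    ∃ π : Equiv.Perm (Fin n), t = s.perm π ∧ (2 ≤ n → Equiv.Perm.sign π = (-1) ^ j) := by
  rw [iterate_flip_oriented] at h
  obtain ⟨π, hπ, e⟩ := Quotient.exact h.symm
  refine ⟨flipPerm n ^ j * π, by rw [e, perm_perm], fun hn => ?_⟩
  rw [Equiv.Perm.sign_mul, hπ, sign_flipPerm_pow j hn, mul_one]

/-- `p.cycleRange.symm` brings the vertex `p` to the front, keeps the order of the others and has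
sign `(-1)^p`. It reduces every face to the one opposite the initial vertex, the only one that
`consEquiv` sees. -/
theorem perm_face_zero (t : X.OrderedCell (n + 1)) (p : Fin (n + 1)) :
    (t.perm p.cycleRange.symm).face 0 = t.face p := by
  ext i
  show t.vert (p.cycleRange.symm (Fin.succAbove 0 i)) = t.vert (p.succAbove i)
  rw [Fin.succAbove_zero, Fin.cycleRange_symm_succ]

theorem link_face (t : X.OrderedCell (n + 1)) (p : Fin (n + 1)) :
    X.Link (t.face p).cell (t.vert p) := by
  have h0 : t.vert p ∉ (t.face p).cell := by
    simp [cell, face, Fin.succAbove_ne]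
  refine ⟨h0, ?_⟩
  convert t.mem using 1
  ext x
  simp only [cell, face, Finset.mem_cons, Finset.mem_map, Finset.mem_univ, true_and]
  constructor
  · rintro (rfl | ⟨i, rfl⟩)
    exacts [⟨p, rfl⟩, ⟨_, rfl⟩]
  · rintro ⟨i, rfl⟩
    by_cases h : i = p
    · exact Or.inl (by rw [h])
    · obtain ⟨j, rfl⟩ := Fin.exists_succAbove_eq h
      exact Or.inr ⟨j, rfl⟩

theorem cons_face (t : X.OrderedCell (n + 1)) (p : Fin (n + 1))
    (h : X.Link (t.face p).cell (t.vert p)) :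
    (t.face p).cons (t.vert p) h = t.perm p.cycleRange.symm := by
  ext i
  refine Fin.cases ?_ (fun i => ?_) i
  · show t.vert p = t.vert (p.cycleRange.symm 0)
    rw [Fin.cycleRange_symm_zero]
  · show t.vert (p.succAbove i) = t.vert (p.cycleRange.symm i.succ)
    rw [Fin.cycleRange_symm_succ]

theorem sign_cycleRange_symm (p : Fin n) :
    Equiv.Perm.sign p.cycleRange.symm = (-1) ^ (p : ℕ) := by
  rw [Equiv.Perm.sign_symm, Fin.sign_cycleRange]

theorem eq_perm_of_cons_eq_perm {s s' : X.OrderedCell n} {v : V} {h : X.Link s.cell v}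
    {h' : X.Link s'.cell v} {κ : Equiv.Perm (Fin (n + 1))}
    (e : s'.cons v h' = (s.cons v h).perm κ) :
    ∃ ρ : Equiv.Perm (Fin n), s' = s.perm ρ ∧ Equiv.Perm.sign ρ = Equiv.Perm.sign κ := by
  have h0 : κ 0 = 0 := by
    apply (s.cons v h).vert.injective
    have := congrFun (congrArg (fun t : X.OrderedCell (n + 1) => (t.vert : Fin (n + 1) → V)) e) 0
    exact this.symm
  obtain ⟨ρ, rfl, hρ⟩ := exists_eq_decomposeFin_symm κ h0
  refine ⟨ρ, ?_, hρ⟩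
  have h'' : X.Link (s.perm ρ).cell v := by rwa [cell_perm]
  rw [← cons_perm s ρ v h h''] at e
  have := congrArg (fun t => t.face 0) e
  exact this

theorem cell_cons (s : X.OrderedCell n) (v : V) (h : X.Link s.cell v) :
    (s.cons v h).cell = Finset.cons v s.cell h.1 := by
  ext x
  simp [cell, cons, Fin.exists_fin_succ, eq_comm]

theorem vert_mem_cell (s : X.OrderedCell n) (i : Fin n) : s.vert i ∈ s.cell :=
  Finset.mem_map_of_mem _ (Finset.mem_univ i)

theorem exists_vert_eq {s : X.OrderedCell n} {v : V} (h : v ∈ s.cell) : ∃ i, s.vert i = v := by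
  simpa [cell] using h

theorem link_cons_face {s : X.OrderedCell (n + 1)} {v : V} (h : X.Link s.cell v)
    (i : Fin (n + 1)) : X.Link (s.face i).cell v := by
  obtain ⟨h1, h2⟩ := h
  have hsub : (s.face i).cell ⊆ s.cell := by
    intro x hx
    obtain ⟨j, rfl⟩ := exists_vert_eq hx
    exact s.vert_mem_cell _
  exact ⟨fun h => h1 (hsub h), X.down_closed _ h2 _ (Finset.cons_subset_cons.2 hsub)⟩

theorem cons_face_succ (s : X.OrderedCell (n + 1)) (v : V) (h : X.Link s.cell v)
    (i : Fin (n + 1)) :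
    (s.cons v h).face i.succ = (s.face i).cons v (link_cons_face h i) := by
  ext j
  refine Fin.cases ?_ (fun j => ?_) j
  · rfl
  · show (Fin.cons v s.vert : Fin (n + 2) → V) (i.succ.succAbove j.succ) = s.vert (i.succAbove j)
    rw [Fin.succ_succAbove_succ]; rfl

end OrderedCell

namespace OrientedCell

theorem exists_oriented_eq (σ : X.OrientedCell n) : ∃ s : X.OrderedCell n, s.oriented = σ :=
  Quotient.exists_rep σ

@[simp] theorem flip_flip (σ : X.OrientedCell n) : σ.flip.flip = σ := by
  obtain ⟨s, rfl⟩ := σ.exists_oriented_eq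
  rw [OrderedCell.oriented_flip, OrderedCell.oriented_flip, OrderedCell.perm_perm,
    flipPerm_mul_self, OrderedCell.perm_one]

theorem flip_injective : Function.Injective (flip : X.OrientedCell n → X.OrientedCell n) :=
  Function.LeftInverse.injective flip_flip

theorem flip_eq_self_of_lt_two (h : n < 2) (σ : X.OrientedCell n) : σ.flip = σ := by
  obtain ⟨s, rfl⟩ := σ.exists_oriented_eq
  rw [OrderedCell.oriented_flip, perm_eq_one_of_lt_two h (flipPerm n), OrderedCell.perm_one]

theorem flip_ne (h : 2 ≤ n) (σ : X.OrientedCell n) : σ.flip ≠ σ := by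
  obtain ⟨s, rfl⟩ := σ.exists_oriented_eq
  intro e
  obtain ⟨π, hπ, hs⟩ := OrderedCell.eq_perm_of_oriented_eq (j := 1) (s := s) (t := s) e.symm
  have : π = 1 := s.perm_injective hπ.symm
  have hs := hs h
  rw [this] at hs
  simp at hs

theorem flip_eq_iff {σ τ : X.OrientedCell n} : σ.flip = τ ↔ σ = τ.flip :=
  ⟨fun h => by rw [← h, flip_flip], fun h => by rw [h, flip_flip]⟩

@[simp] theorem cell_oriented (s : X.OrderedCell n) : s.oriented.cell = s.cell := rfl

@[simp] theorem cell_flip (σ : X.OrientedCell n) : σ.flip.cell = σ.cell := by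
  obtain ⟨s, rfl⟩ := σ.exists_oriented_eq
  rw [OrderedCell.oriented_flip, cell_oriented, cell_oriented, OrderedCell.cell_perm]

@[simp] theorem cell_iterate_flip (σ : X.OrientedCell n) (j : ℕ) : (flip^[j] σ).cell = σ.cell := by
  induction j with
  | zero => rfl
  | succ j ih => rw [Function.iterate_succ_apply', cell_flip, ih]

theorem iterate_flip_add_two (σ : X.OrientedCell n) (j : ℕ) : flip^[j + 2] σ = flip^[j] σ := by
  rw [Function.iterate_succ_apply', Function.iterate_succ_apply', flip_flip]

theorem iterate_flip_two_mul (σ : X.OrientedCell n) (j : ℕ) : flip^[2 * j] σ = σ := by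
  induction j with
  | zero => rfl
  | succ j ih => rw [mul_add, mul_one, iterate_flip_add_two, ih]

theorem iterate_flip_involutive (σ : X.OrientedCell n) (j : ℕ) : flip^[j] (flip^[j] σ) = σ := by
  rw [← Function.iterate_add_apply, ← two_mul, iterate_flip_two_mul]

/-- The faces of an oriented cell, described by adding a vertex in front of an ordered cell. -/
theorem isFaceOf_iff {σ : X.OrientedCell n} {τ : X.OrientedCell (n + 1)} (hn : 1 ≤ n) :
    σ.IsFaceOf τ ↔ ∃ (s : X.OrderedCell n) (v : V) (h : X.Link s.cell v) (j : ℕ),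
      σ = flip^[j] s.oriented ∧ τ = flip^[j] (s.cons v h).oriented := by
  constructor
  · rintro ⟨t, rfl, i, rfl⟩
    refine ⟨t.face i, t.vert i, t.link_face i, i, rfl, ?_⟩
    rw [OrderedCell.cons_face, OrderedCell.oriented_perm t (j := i) fun _ =>
      OrderedCell.sign_cycleRange_symm i, iterate_flip_involutive]
  · rintro ⟨s, v, h, j, rfl, rfl⟩
    by_cases h2 : 2 ≤ n
    · have h' : X.Link (s.perm (flipPerm n ^ j)).cell v := by rwa [OrderedCell.cell_perm]
      refine ⟨(s.perm (flipPerm n ^ j)).cons v h', ?_, 0, ?_⟩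
      · rw [cons_perm s _ v h h']
        refine OrderedCell.oriented_perm _ fun _ => ?_
        rw [Equiv.Perm.decomposeFin.symm_sign]
        simp [sign_flipPerm h2]
      · exact OrderedCell.iterate_flip_oriented s j
    -- Vertices have one orientation but edges have two, so a flip of the edge cannot be absorbed by
    -- reordering the face. For odd `j` the edge is written in reverse, and the vertex becomes its
    -- face with index `1`.
    · obtain rfl : n = 1 := by omega
      have hfl : ∀ j (σ : X.OrientedCell 1), flip^[j] σ = σ := fun j σ =>
        Function.iterate_fixed (flip_eq_self_of_lt_two (by omega) σ) j
      rcases Nat.even_or_odd' j with ⟨m, rfl | rfl⟩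
      · refine ⟨s.cons v h, (iterate_flip_two_mul _ _).symm, 0, ?_⟩
        rw [hfl, hfl]; rfl
      · refine ⟨(s.cons v h).perm (Equiv.swap 0 1), ?_, 1, ?_⟩
        · rw [Function.iterate_succ_apply', iterate_flip_two_mul]; rfl
        · rw [hfl, hfl]
          congr 1
          ext i
          obtain rfl : i = 0 := Subsingleton.elim _ _
          show s.vert 0 = (s.cons v h).vert (Equiv.swap 0 1 (Fin.succAbove 1 0))
          rfl

theorem IsFaceOf.flip {σ : X.OrientedCell n} {τ : X.OrientedCell (n + 1)} (hn : 1 ≤ n)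
    (h : σ.IsFaceOf τ) : σ.flip.IsFaceOf τ.flip := by
  rw [isFaceOf_iff hn] at h ⊢
  obtain ⟨s, v, h, j, rfl, rfl⟩ := h
  exact ⟨s, v, h, j + 1, by rw [Function.iterate_succ_apply'], by rw [Function.iterate_succ_apply']⟩

theorem Neighbor.flip {σ σ' : X.OrientedCell n} (hn : 1 ≤ n) (h : σ.Neighbor σ') :
    σ.flip.Neighbor σ'.flip := by
  obtain ⟨h1, τ, h2, h3⟩ := h
  exact ⟨by simpa using h1, τ.flip, h2.flip hn, h3.flip hn⟩

theorem neighbor_flip_iff {σ σ' : X.OrientedCell n} (hn : 1 ≤ n) :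
    σ.flip.Neighbor σ'.flip ↔ σ.Neighbor σ' :=
  ⟨fun h => by simpa using h.flip hn, fun h => h.flip hn⟩

/-- Moving the vertex `s_i` of the cell `v, s_0, …, s_n` to the front. -/
theorem cons_cons_face_eq_perm (s : X.OrderedCell (n + 1)) (v : V) (h : X.Link s.cell v)
    (i : Fin (n + 1)) :
    ∃ h' : X.Link ((s.face i).cons v (OrderedCell.link_cons_face h i)).cell (s.vert i),
      ((s.face i).cons v (OrderedCell.link_cons_face h i)).cons (s.vert i) h'
        = (s.cons v h).perm i.succ.cycleRange.symm := by
  have h1 := (s.cons v h).link_face i.succ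
  have h2 := (s.cons v h).cons_face i.succ h1
  have h3 : X.Link ((s.face i).cons v (OrderedCell.link_cons_face h i)).cell (s.vert i) := by
    rw [← OrderedCell.cons_face_succ]; exact h1
  refine ⟨h3, ?_⟩
  rw [← h2]
  congr 1
  rw [OrderedCell.cons_face_succ]

/-- The faces of `vs` other than `s` arise by replacing some `s_i` by `v`. Deleting the vertex `i +
1` of `vs` induces the sign `(-1)^(i+1)`, and the reversal required in the definition of neighbors
turns it into `(-1)^i`. The neighbor stands on the left because the walk sums over incoming
transitions. -/
theorem neighbor_oriented_iff (s : X.OrderedCell (n + 1)) (σ' : X.OrientedCell (n + 1)) :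
    σ'.Neighbor s.oriented ↔ ∃ (v : V) (h : X.Link s.cell v) (i : Fin (n + 1)),
      σ' = flip^[(i : ℕ)] ((s.face i).cons v (OrderedCell.link_cons_face h i)).oriented := by
  constructor
  · rintro ⟨hne, τ, h1, h2⟩
    rw [isFaceOf_iff (by omega)] at h1 h2
    obtain ⟨s', v', hv', j, rfl, rfl⟩ := h1
    obtain ⟨s'', v, hv'', l, hs'', hτ⟩ := h2
    have hs : s.oriented = flip^[l + 1] s''.oriented := by
      rw [Function.iterate_succ_apply', ← hs'', flip_flip]
    obtain ⟨π, rfl, hπ⟩ := OrderedCell.eq_perm_of_oriented_eq hs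
    have hv : X.Link (s''.perm π).cell v := by rwa [OrderedCell.cell_perm]
    set s := s''.perm π with hs_def
    have e1 : s.cons v hv = (s''.cons v hv'').perm (Equiv.Perm.decomposeFin.symm (0, π)) :=
      cons_perm s'' π v hv'' hv
    have e2 : (s'.cons v' hv').oriented = flip^[j + l] (s''.cons v hv'').oriented := by
      rw [Function.iterate_add_apply, ← hτ, iterate_flip_involutive]
    obtain ⟨ρ, e3, hρ⟩ := OrderedCell.eq_perm_of_oriented_eq e2
    have hρ := hρ (by omega)
    have hc : Finset.cons v' s'.cell hv'.1 = Finset.cons v s.cell hv.1 := by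
      rw [← OrderedCell.cell_cons s' v' hv', ← OrderedCell.cell_cons s v hv, e3, e1,
        OrderedCell.cell_perm, OrderedCell.cell_perm]
    have hvv : v' ≠ v := by
      classical
      rintro rfl
      apply hne
      simp only [cell_iterate_flip, cell_oriented]
      rw [Finset.cons_eq_insert, Finset.cons_eq_insert] at hc
      rw [← Finset.erase_insert hv'.1, hc, Finset.erase_insert hv.1]
    have hv's : v' ∈ s.cell := by
      have : v' ∈ Finset.cons v s.cell hv.1 := hc ▸ Finset.mem_cons_self _ _
      exact (Finset.mem_cons.1 this).resolve_left hvv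
    obtain ⟨i, rfl⟩ := OrderedCell.exists_vert_eq hv's
    refine ⟨v, hv, i, ?_⟩
    obtain ⟨h', e4⟩ := cons_cons_face_eq_perm s v hv i
    -- Both orderings of the `d`-cell now begin with `s_i`, so the permutation between them
    -- restricts to one of the remaining vertices with the same sign.
    have e5 : s'.cons (s.vert i) hv'
        = (((s.face i).cons v (OrderedCell.link_cons_face hv i)).cons (s.vert i) h').perm
          ((Equiv.Perm.decomposeFin.symm (0, π) * i.succ.cycleRange.symm)⁻¹ * ρ) := by
      rw [e4, e1, OrderedCell.perm_perm, OrderedCell.perm_perm, ← mul_assoc, mul_inv_cancel_left, e3]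
    obtain ⟨κ, rfl, hκ⟩ := OrderedCell.eq_perm_of_cons_eq_perm e5
    by_cases hn : 2 ≤ n + 1
    · rw [OrderedCell.oriented_perm _ (j := i + j), ← Function.iterate_add_apply,
        show j + (i + j) = i + 2 * j by ring, Function.iterate_add_apply, iterate_flip_two_mul]
      intro _
      rw [hκ]
      simp only [Equiv.Perm.sign_mul, Equiv.Perm.sign_inv, OrderedCell.sign_cycleRange_symm,
        Equiv.Perm.decomposeFin.symm_sign, hπ hn, hρ, if_true, one_mul, Fin.val_succ]
      have hl : ((-1 : ℤˣ) ^ l) * (-1) ^ l = 1 := by rw [← mul_pow]; simp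
      calc (-1 : ℤˣ) ^ (l + 1) * (-1) ^ ((i : ℕ) + 1) * (-1) ^ (j + l)
          = ((-1) ^ l * (-1) ^ l) * (((-1) * (-1)) * ((-1) ^ (i : ℕ) * (-1) ^ j)) := by
            simp only [pow_add, pow_one, mul_comm, mul_left_comm, mul_assoc]
        _ = _ := by rw [hl, pow_add]; simp
    · have hfl : ∀ j (σ : X.OrientedCell (n + 1)), flip^[j] σ = σ := fun j σ =>
        Function.iterate_fixed (flip_eq_self_of_lt_two (by omega) σ) j
      rw [hfl, hfl, perm_eq_one_of_lt_two (by omega) κ, OrderedCell.perm_one]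
  · rintro ⟨v, h, i, rfl⟩
    refine ⟨?_, (s.cons v h).oriented.flip, ?_, ?_⟩
    · rw [cell_iterate_flip, cell_oriented, cell_oriented, OrderedCell.cell_cons]
      intro e
      exact h.1 (e ▸ Finset.mem_cons_self _ _)
    · rw [isFaceOf_iff (by omega)]
      obtain ⟨h', e4⟩ := cons_cons_face_eq_perm s v h i
      refine ⟨_, _, h', i, rfl, ?_⟩
      rw [e4, OrderedCell.oriented_perm (s.cons v h) (j := i + 1) fun _ => by
        rw [OrderedCell.sign_cycleRange_symm]; rfl, ← Function.iterate_add_apply,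
        show (i : ℕ) + (i + 1) = 1 + 2 * i by ring, Function.iterate_add_apply,
        iterate_flip_two_mul]
      rfl
    · rw [isFaceOf_iff (by omega)]
      exact ⟨s, v, h, 1, rfl, rfl⟩

/-- The neighbors of the oriented cell of `s` correspond to the pairs of a vertex `v ◁ s` and an
index of a vertex of `s` to be replaced by `v`. -/
theorem neighbor_parametrization_injective (s : X.OrderedCell (n + 1)) :
    Function.Injective fun p : {v // X.Link s.cell v} × Fin (n + 1) =>
      flip^[(p.2 : ℕ)] ((s.face p.2).cons p.1 (OrderedCell.link_cons_face p.1.2 p.2)).oriented := by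
  rintro ⟨⟨v, hv⟩, i⟩ ⟨⟨w, hw⟩, j⟩ h
  have h : Finset.cons v (s.face i).cell (OrderedCell.link_cons_face hv i).1
      = Finset.cons w (s.face j).cell (OrderedCell.link_cons_face hw j).1 := by
    have := congrArg cell h
    simpa only [cell_iterate_flip, cell_oriented, OrderedCell.cell_cons] using this
  have hsub : ∀ (i : Fin (n + 1)) x, x ∈ (s.face i).cell ↔ x ∈ s.cell ∧ x ≠ s.vert i := by
    intro i x
    constructor
    · intro hx
      obtain ⟨j, rfl⟩ := OrderedCell.exists_vert_eq hx
      exact ⟨s.vert_mem_cell _, fun h => Fin.succAbove_ne i j (s.vert.injective h)⟩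
    · rintro ⟨hx, hne⟩
      obtain ⟨j, rfl⟩ := OrderedCell.exists_vert_eq hx
      obtain ⟨l, rfl⟩ := Fin.exists_succAbove_eq (fun h => hne (by rw [h]) : j ≠ i)
      exact (s.face i).vert_mem_cell l
  -- The new cell determines `v` as its only vertex outside `s`, and `s_i` as the only vertex of `s`
  -- that it lacks.
  have hvw : v = w := by
    have : v ∈ Finset.cons w (s.face j).cell (OrderedCell.link_cons_face hw j).1 :=
      h ▸ Finset.mem_cons_self _ _
    rcases Finset.mem_cons.1 this with h | h
    · exact h
    · exact absurd ((hsub _ _).1 h).1 hv.1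
  subst hvw
  have hij : i = j := by
    by_contra hne
    have : s.vert i ∈ Finset.cons v (s.face i).cell (OrderedCell.link_cons_face hv i).1 := by
      rw [h, Finset.mem_cons]
      exact Or.inr ((hsub _ _).2 ⟨s.vert_mem_cell i, fun e => hne (s.vert.injective e)⟩)
    rcases Finset.mem_cons.1 this with h | h
    · exact hv.1 (h ▸ s.vert_mem_cell i)
    · exact ((hsub _ _).1 h).2 rfl
  rw [hij]

end OrientedCell

/-- The bound on `j` takes care of vertices, where the flip is the identity and forms need not be
antisymmetric: there it forces `j = 0`. -/
theorem IsForm.iterate_flip {f : X.OrientedCell n → ℝ} (hf : IsForm f) (σ : X.OrientedCell n)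
    {j : ℕ} (hj : j < n) : f (OrientedCell.flip^[j] σ) = (-1) ^ j * f σ := by
  by_cases hn : 2 ≤ n
  · clear hj
    induction j with
    | zero => simp
    | succ j ih => rw [Function.iterate_succ_apply', hf hn, ih, pow_succ]; ring
  · obtain rfl : j = 0 := by omega
    simp

end CellComplex

/-! ### Dirac forms and alternating sums over faces. -/

namespace CellComplex

variable {V : Type*} {X : CellComplex V} {n : ℕ}

namespace OrientedCell

theorem dirac_self (σ : X.OrientedCell n) : σ.dirac σ = 1 := by simp [dirac]

theorem isForm_dirac (σ : X.OrientedCell n) : IsForm σ.dirac := by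
  intro hn σ'
  have hne := flip_ne hn σ
  by_cases h1 : σ' = σ
  · subst h1
    simp [dirac, hne]
  · by_cases h2 : σ' = σ.flip
    · subst h2
      simp [dirac, hne]
    · have h3 : σ'.flip ≠ σ := fun h => h2 (flip_eq_iff.1 h)
      have h4 : σ'.flip ≠ σ.flip := fun h => h1 (flip_injective h)
      simp [dirac, h1, h2, h3, h4]

theorem dirac_perm (s : X.OrderedCell n) (π : Equiv.Perm (Fin n)) :
    s.oriented.dirac (s.perm π).oriented = ((Equiv.Perm.sign π : ℤ) : ℝ) := by
  rw [(isForm_dirac s.oriented).perm, dirac_self, mul_one]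

theorem exists_perm_of_dirac_ne_zero {s t : X.OrderedCell n}
    (h : s.oriented.dirac t.oriented ≠ 0) : ∃ π : Equiv.Perm (Fin n), s.perm π = t := by
  rw [dirac] at h
  split_ifs at h with h1 h2
  · obtain ⟨π, hπ, -⟩ := OrderedCell.eq_perm_of_oriented_eq (j := 0) h1
    exact ⟨π, hπ.symm⟩
  · obtain ⟨π, hπ, -⟩ := OrderedCell.eq_perm_of_oriented_eq (j := 1) h2
    exact ⟨π, hπ.symm⟩
  · exact absurd rfl h

theorem support_dirac_mul_subset (s : X.OrderedCell n) (F : X.OrderedCell n → ℝ) :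
    (Function.support fun t : X.OrderedCell n => s.oriented.dirac t.oriented * F t)
      ⊆ Set.range fun π => s.perm π := by
  intro t ht
  exact exists_perm_of_dirac_ne_zero (left_ne_zero_of_mul ht)

theorem summable_dirac_mul (s : X.OrderedCell n) (F : X.OrderedCell n → ℝ) :
    Summable fun t : X.OrderedCell n => s.oriented.dirac t.oriented * F t :=
  summable_of_hasFiniteSupport ((Set.finite_range _).subset (support_dirac_mul_subset s F))

theorem tsum_dirac_mul (s : X.OrderedCell n) (F : X.OrderedCell n → ℝ) :
    ∑' t : X.OrderedCell n, s.oriented.dirac t.oriented * F t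
      = ∑ π : Equiv.Perm (Fin n), ((Equiv.Perm.sign π : ℤ) : ℝ) * F (s.perm π) := by
  rw [← s.perm_injective.tsum_eq (support_dirac_mul_subset s F), tsum_fintype]
  simp only [dirac_perm]

end OrientedCell

/-- For `G` antisymmetric under reordering, `sign ρ • G` of the face of `t ∘ ρ` opposite to its
initial vertex depends on `ρ` only through `ρ 0`. -/
theorem sign_mul_face_zero_eq {G : X.OrderedCell n → ℝ}
    (hG : ∀ s (e : Equiv.Perm (Fin n)), G (s.perm e) = ((Equiv.Perm.sign e : ℤ) : ℝ) * G s)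
    (t : X.OrderedCell (n + 1)) {ρ ρ' : Equiv.Perm (Fin (n + 1))} (h : ρ 0 = ρ' 0) :
    ((Equiv.Perm.sign ρ : ℤ) : ℝ) * G ((t.perm ρ).face 0)
      = ((Equiv.Perm.sign ρ' : ℤ) : ℝ) * G ((t.perm ρ').face 0) := by
  obtain ⟨e, he, hs⟩ := exists_eq_decomposeFin_symm (ρ'⁻¹ * ρ) (by simp [Equiv.Perm.mul_apply, h])
  have hρ : ρ = ρ' * Equiv.Perm.decomposeFin.symm (0, e) := by rw [← he, mul_inv_cancel_left]
  have hface : (t.perm ρ).face 0 = ((t.perm ρ').face 0).perm e := by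
    ext i
    show t.vert (ρ (Fin.succAbove 0 i)) = t.vert (ρ' (Fin.succAbove 0 (e i)))
    rw [hρ, Equiv.Perm.mul_apply, Fin.succAbove_zero, Equiv.Perm.decomposeFin_symm_apply_succ]
    simp
  rw [hface, hG, ← mul_assoc, ← Int.cast_mul, ← Units.val_mul]
  congr 3
  rw [hs, Equiv.Perm.sign_mul, Equiv.Perm.sign_inv, mul_left_comm, Int.units_mul_self, mul_one]

theorem sign_mul_face_zero_cycleRange (G : X.OrderedCell n → ℝ) (t : X.OrderedCell (n + 1))
    (p : Fin (n + 1)) :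
    ((Equiv.Perm.sign p.cycleRange.symm : ℤ) : ℝ) * G ((t.perm p.cycleRange.symm).face 0)
      = (-1) ^ (p : ℕ) * G (t.face p) := by
  rw [OrderedCell.perm_face_zero, OrderedCell.sign_cycleRange_symm]
  simp

/-- Reindexing by `p ↦ π p` matches the faces opposite the same vertex; `sign_mul_face_zero_eq`
accounts for the signs. This makes coboundaries antisymmetric. -/
theorem alternating_sum_face_perm {G : X.OrderedCell n → ℝ}
    (hG : ∀ s (e : Equiv.Perm (Fin n)), G (s.perm e) = ((Equiv.Perm.sign e : ℤ) : ℝ) * G s)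
    (t : X.OrderedCell (n + 1)) (π : Equiv.Perm (Fin (n + 1))) :
    ∑ p : Fin (n + 1), (-1) ^ (p : ℕ) * G ((t.perm π).face p)
      = ((Equiv.Perm.sign π : ℤ) : ℝ) * ∑ p : Fin (n + 1), (-1) ^ (p : ℕ) * G (t.face p) := by
  rw [Finset.mul_sum, ← Equiv.sum_comp π (fun p : Fin (n + 1) =>
    ((Equiv.Perm.sign π : ℤ) : ℝ) * ((-1) ^ (p : ℕ) * G (t.face p)))]
  refine Finset.sum_congr rfl fun p _ => ?_
  rw [← sign_mul_face_zero_cycleRange, ← sign_mul_face_zero_cycleRange,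
    ← sign_mul_face_zero_eq hG t (ρ := π * p.cycleRange.symm) (by
      rw [Equiv.Perm.mul_apply, Fin.cycleRange_symm_zero, Fin.cycleRange_symm_zero]),
    OrderedCell.perm_perm, Equiv.Perm.sign_mul, ← mul_assoc, ← Int.cast_mul, ← Units.val_mul,
    ← mul_assoc, Int.units_mul_self, one_mul]

/-- The permutations are grouped by the vertex `p` that they put in front; each group has `n!`
members, all contributing the same term. -/
theorem sum_perm_sign_mul_face_zero {G : X.OrderedCell n → ℝ}
    (hG : ∀ s (e : Equiv.Perm (Fin n)), G (s.perm e) = ((Equiv.Perm.sign e : ℤ) : ℝ) * G s)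
    (t : X.OrderedCell (n + 1)) :
    ∑ π : Equiv.Perm (Fin (n + 1)), ((Equiv.Perm.sign π : ℤ) : ℝ) * G ((t.perm π).face 0)
      = (n.factorial : ℝ) * ∑ p : Fin (n + 1), (-1) ^ (p : ℕ) * G (t.face p) := by
  rw [← Equiv.Perm.decomposeFin.symm.sum_comp, Fintype.sum_prod_type, Finset.mul_sum]
  refine Finset.sum_congr rfl fun p _ => ?_
  rw [← sign_mul_face_zero_cycleRange]
  rw [Finset.sum_congr rfl fun e _ => sign_mul_face_zero_eq hG t
    (ρ := Equiv.Perm.decomposeFin.symm (p, e)) (ρ' := p.cycleRange.symm) (by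
      rw [Equiv.Perm.decomposeFin_symm_apply_zero, Fin.cycleRange_symm_zero])]
  simp [Fintype.card_perm]

end CellComplex

/-! ### The adjoint of the boundary and a formula for the upper Laplacian. -/

namespace BoundedComplex

open CellComplex

variable {V : Type*} {d : ℕ} {X : BoundedComplex V d} {n : ℕ}

/-- The Dirac form `𝟙_σ` as a square-summable form. -/
noncomputable def diracForm (σ : X.OrientedCell n) : X.L2Form n :=
  L2Form.mk σ.dirac (OrientedCell.isForm_dirac σ) (by
    obtain ⟨s, rfl⟩ := σ.exists_oriented_eq
    refine (OrientedCell.summable_dirac_mul s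
      (fun t => X.weight t.cell * s.oriented.dirac t.oriented)).congr fun t => ?_
    ring)

theorem diracForm_apply (σ σ' : X.OrientedCell n) : diracForm σ σ' = σ.dirac σ' := rfl

/-- The `n!` orderings of the cell contribute equally and cancel the normalization, so `𝟙_σ`
represents evaluation at `σ` up to the weight. -/
theorem inner_diracForm (s : X.OrderedCell n) (f : X.L2Form n) :
    inner ℝ (diracForm s.oriented) f = X.weight s.cell * f s.oriented := by
  rw [L2Form.inner_eq]
  have : ∀ t : X.OrderedCell n, X.weight t.cell * diracForm s.oriented t.oriented * f t.oriented
      = s.oriented.dirac t.oriented * (X.weight t.cell * f t.oriented) := fun t => by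
    rw [diracForm_apply]; ring
  simp only [this]
  rw [OrientedCell.tsum_dirac_mul]
  have h2 : ∀ π : Equiv.Perm (Fin n), ((Equiv.Perm.sign π : ℤ) : ℝ) *
      (X.weight (s.perm π).cell * f (s.perm π).oriented) = X.weight s.cell * f s.oriented := by
    intro π
    have h3 : ((Equiv.Perm.sign π : ℤ) : ℝ) * ((Equiv.Perm.sign π : ℤ) : ℝ) = 1 := by
      rw [← Int.cast_mul, ← Units.val_mul, Int.units_mul_self]; simp
    rw [OrderedCell.cell_perm, f.isForm.perm]
    linear_combination (X.weight s.cell * f s.oriented) * h3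
  simp only [h2, Finset.sum_const, Finset.card_univ, Fintype.card_perm, Fintype.card_fin,
    nsmul_eq_mul]
  field_simp

theorem L2Form.weight_mul_perm (f : X.L2Form n) (s : X.OrderedCell n) (e : Equiv.Perm (Fin n)) :
    X.weight (s.perm e).cell * f (s.perm e).oriented
      = ((Equiv.Perm.sign e : ℤ) : ℝ) * (X.weight s.cell * f s.oriented) := by
  rw [OrderedCell.cell_perm, f.isForm.perm]; ring

/-- `(∂_d^* f)(t) = ∑_p (-1)^p w(t ∖ t_p) f(t ∖ t_p)`. -/
theorem adjoint_boundary_apply (f : X.L2Form d) (t : X.OrderedCell (d + 1)) :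
    ContinuousLinearMap.adjoint X.boundary f t.oriented
      = ∑ p : Fin (d + 1), (-1) ^ (p : ℕ) *
        (X.weight (t.face p).cell * f (t.face p).oriented) := by
  -- Top cells have weight `1`, so pairing with `𝟙_t` reads off the value at `t`.
  have h1 := inner_diracForm t (ContinuousLinearMap.adjoint X.boundary f)
  rw [weight_top, one_mul, ContinuousLinearMap.adjoint_inner_right, L2Form.inner_eq] at h1
  rw [← h1]
  set F : X.OrderedCell (d + 1) → ℝ := fun u =>
    t.oriented.dirac u.oriented * (X.weight (u.face 0).cell * f (u.face 0).oriented) with hF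
  have hsum : Summable F := OrientedCell.summable_dirac_mul t _
  have h2 : ∀ s : X.OrderedCell d,
      X.weight s.cell * X.boundary (diracForm t.oriented) s.oriented * f s.oriented
        = ∑' v : {v // X.Link s.cell v}, F (consEquiv X.toCellComplex d ⟨s, v⟩) := by
    intro s
    show _ = ∑' v : {v // X.Link s.cell v},
      t.oriented.dirac (s.cons v v.2).oriented * (X.weight s.cell * f s.oriented)
    rw [tsum_mul_right, boundary_apply]
    simp only [diracForm_apply]
    ring
  simp only [h2]
  have h3 := ((consEquiv X.toCellComplex d).summable_iff.2 hsum).tsum_sigma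
  simp only [Function.comp_apply] at h3
  rw [← h3, (consEquiv X.toCellComplex d).tsum_eq F, hF, OrientedCell.tsum_dirac_mul t
    (fun u => X.weight (u.face 0).cell * f (u.face 0).oriented),
    sum_perm_sign_mul_face_zero (G := fun s => X.weight s.cell * f s.oriented)
      (fun s e => f.weight_mul_perm s e)]
  field_simp

theorem upperLaplacian_isPositive (X : BoundedComplex V d) : X.upperLaplacian.IsPositive :=
  ContinuousLinearMap.isPositive_self_comp_adjoint X.boundary

theorem inner_upperLaplacian_self (y : X.L2Form d) :
    inner ℝ (X.upperLaplacian y) y = ‖ContinuousLinearMap.adjoint X.boundary y‖ ^ 2 := by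
  rw [upperLaplacian, ContinuousLinearMap.comp_apply, ← ContinuousLinearMap.adjoint_inner_right,
    real_inner_self_eq_norm_sq]

theorem inner_upperLaplacian_self_le (y : X.L2Form d) :
    inner ℝ (X.upperLaplacian y) y ≤ ((d : ℝ) + 1) * ‖y‖ ^ 2 := by
  rw [inner_upperLaplacian_self]
  have h1 : ‖X.boundary‖ ≤ √((d : ℝ) + 1) := LinearMap.mkContinuous_norm_le _ (by positivity) _
  have h2 : ‖ContinuousLinearMap.adjoint X.boundary y‖ ≤ √((d : ℝ) + 1) * ‖y‖ := by
    refine (ContinuousLinearMap.le_opNorm _ _).trans ?_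
    rw [LinearIsometryEquiv.norm_map]
    gcongr
  calc _ ≤ (√((d : ℝ) + 1) * ‖y‖) ^ 2 := by gcongr
    _ = _ := by rw [mul_pow, Real.sq_sqrt (by positivity)]

section Positive

variable {k : ℕ} {Y : BoundedComplex V (k + 1)}

/-- The sum `∑_{σ' ∼ σ} w(σ') f(σ')` over the neighbors, with the signs of an ordering of `σ`. -/
noncomputable def neighborSum (f : Y.OrientedCell (k + 1) → ℝ) (s : Y.OrderedCell (k + 1)) : ℝ :=
  ∑' v : {v // Y.Link s.cell v}, ∑ i : Fin (k + 1), (-1) ^ (i : ℕ) *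
    (Y.weight ((s.face i).cons v (OrderedCell.link_cons_face v.2 i)).cell *
      f ((s.face i).cons v (OrderedCell.link_cons_face v.2 i)).oriented)

/-- In `∂*f(vs)` the face opposite `v` is `s` itself; its term `w(s) f(s)`, summed over the `deg s`
vertices `v`, gives `f(s)`. The other faces are the neighbors of `s`. -/
theorem upperLaplacian_apply (f : Y.L2Form (k + 1)) (s : Y.OrderedCell (k + 1)) :
    Y.upperLaplacian f s.oriented = f s.oriented - neighborSum f s := by
  have := finite_link_cell s
  rw [upperLaplacian, ContinuousLinearMap.comp_apply, boundary_apply]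
  have h : ∀ v : {v // Y.Link s.cell v},
      ContinuousLinearMap.adjoint Y.boundary f (s.cons v v.2).oriented
      = Y.weight s.cell * f s.oriented - ∑ i : Fin (k + 1), (-1) ^ (i : ℕ) *
        (Y.weight ((s.face i).cons v (OrderedCell.link_cons_face v.2 i)).cell *
          f ((s.face i).cons v (OrderedCell.link_cons_face v.2 i)).oriented) := by
    intro v
    rw [adjoint_boundary_apply, Fin.sum_univ_succ, sub_eq_add_neg, ← Finset.sum_neg_distrib]
    congr 1
    · simp; rfl
    · refine Finset.sum_congr rfl fun i _ => ?_
      rw [OrderedCell.cons_face_succ, Fin.val_succ, pow_succ]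
      ring
  simp only [h]
  rw [Summable.tsum_sub Summable.of_finite Summable.of_finite, sum_link_const, neighborSum]

end Positive

end BoundedComplex

/-! ### The walk as powers of an operator, and the criterion for transience. -/

namespace BoundedComplex

open CellComplex

variable {V : Type*} {k : ℕ} {X : BoundedComplex V (k + 1)}

/-- One step of the evolution of the walk, applied to an arbitrary function. -/
theorem hasSum_mul_transition (p : ℝ) (P : X.OrientedCell (k + 1) → ℝ)
    (s : X.OrderedCell (k + 1)) :
    HasSum (fun σ' => P σ' * X.transition p σ' s.oriented)
      (p * P s.oriented + ∑' v : {v // X.Link s.cell v}, ∑ i : Fin (k + 1),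
        P (OrientedCell.flip^[(i : ℕ)]
          ((s.face i).cons v (OrderedCell.link_cons_face v.2 i)).oriented) *
        ((1 - p) / (((k + 1 : ℕ) : ℝ) *
          X.deg ((s.face i).cons v (OrderedCell.link_cons_face v.2 i)).cell))) := by
  classical
  have := finite_link_cell s
  have : Fintype {v // X.Link s.cell v} := Fintype.ofFinite _
  have h1 : HasSum (fun σ' => if σ' = s.oriented then p * P s.oriented else 0)
      (p * P s.oriented) := hasSum_ite_eq _ _
  set g : {v // X.Link s.cell v} × Fin (k + 1) → X.OrientedCell (k + 1) := fun q =>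
    OrientedCell.flip^[(q.2 : ℕ)]
      ((s.face q.2).cons q.1 (OrderedCell.link_cons_face q.1.2 q.2)).oriented with hg
  have hinj : Function.Injective g := OrientedCell.neighbor_parametrization_injective s
  set F : X.OrientedCell (k + 1) → ℝ := fun σ' => if σ'.Neighbor s.oriented then
    P σ' * ((1 - p) / (((k + 1 : ℕ) : ℝ) * X.deg σ'.cell)) else 0 with hF
  have hgn : ∀ q, (g q).Neighbor s.oriented := fun q =>
    (OrientedCell.neighbor_oriented_iff s _).2 ⟨q.1, q.1.2, q.2, rfl⟩
  have h2 : HasSum F (∑ q, F (g q)) := by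
    -- The transitions into `s` come from its finitely many neighbors, enumerated injectively by
    -- `g`.
    refine (hinj.hasSum_iff (fun σ' hσ' => ?_)).1 (hasSum_fintype (F ∘ g))
    rw [hF]
    refine if_neg fun h => hσ' ?_
    obtain ⟨v, hv, i, rfl⟩ := (OrientedCell.neighbor_oriented_iff s _).1 h
    exact ⟨(⟨v, hv⟩, i), rfl⟩
  have h3 : ∀ q, F (g q) = P (g q) * ((1 - p) / (((k + 1 : ℕ) : ℝ) *
      X.deg ((s.face q.2).cons q.1 (OrderedCell.link_cons_face q.1.2 q.2)).cell)) := by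
    intro q
    rw [hF]
    simp only [hgn q, if_true]
    rw [hg]
    simp only [OrientedCell.cell_iterate_flip, OrientedCell.cell_oriented]
  rw [tsum_fintype]
  have h4 := h1.add h2
  rw [Fintype.sum_prod_type] at h4
  simp only [h3] at h4
  refine h4.congr_fun ?_
  intro σ'
  by_cases h : σ' = s.oriented
  · subst h
    have hn : ¬ (s.oriented.Neighbor s.oriented) := fun h => h.1 rfl
    simp [transition, hF, hn, mul_comm]
  · by_cases hn : σ'.Neighbor s.oriented
    · simp [transition, hF, hn, h, Ne.symm h]
    · simp [transition, hF, hn, h, Ne.symm h]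

theorem tsum_mul_transition_of_isForm (p : ℝ) {f : X.OrientedCell (k + 1) → ℝ} (hf : IsForm f)
    (s : X.OrderedCell (k + 1)) :
    ∑' σ', f σ' * X.transition p σ' s.oriented
      = p * f s.oriented + (1 - p) / ((k : ℝ) + 1) * neighborSum f s := by
  have := finite_link_cell s
  rw [(hasSum_mul_transition p f s).tsum_eq, neighborSum, ← tsum_mul_left]
  congr 1
  refine tsum_congr fun v => ?_
  rw [Finset.mul_sum]
  refine Finset.sum_congr rfl fun i _ => ?_
  rw [hf.iterate_flip _ i.2, weight_eq (card_cell _)]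
  push_cast
  rw [div_mul_eq_div_div, div_eq_mul_one_div _ (X.deg _)]
  ring

theorem transition_flip (p : ℝ) (σ σ' : X.OrientedCell (k + 1)) :
    X.transition p σ.flip σ'.flip = X.transition p σ σ' := by
  have h1 : σ'.flip = σ.flip ↔ σ' = σ := OrientedCell.flip_injective.eq_iff
  have h2 : σ.flip.Neighbor σ'.flip ↔ σ.Neighbor σ' :=
    OrientedCell.neighbor_flip_iff (Nat.succ_pos k)
  by_cases h : σ' = σ
  · simp [transition, h]
  · by_cases hn : σ.Neighbor σ'
    · simp [transition, h1, h2, h, hn]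
    · simp [transition, h1, h2, h, hn]

/-- The transition probabilities are invariant under simultaneous flips, so antisymmetrizing the
walk preserves its linear recursion. -/
theorem expectation_succ (p : ℝ) (σ₀ : X.OrientedCell (k + 1)) (n : ℕ)
    (σ : X.OrientedCell (k + 1)) :
    X.expectation p σ₀ (n + 1) σ = ∑' σ', X.expectation p σ₀ n σ' * X.transition p σ' σ := by
  have hs : ∀ (P : X.OrientedCell (k + 1) → ℝ) (σ : X.OrientedCell (k + 1)),
      Summable fun σ' => P σ' * X.transition p σ' σ := by
    intro P σ
    obtain ⟨s, rfl⟩ := σ.exists_oriented_eq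
    exact (hasSum_mul_transition p P s).summable
  unfold expectation
  split_ifs with h
  · let e : X.OrientedCell (k + 1) ≃ X.OrientedCell (k + 1) :=
      ⟨OrientedCell.flip, OrientedCell.flip, OrientedCell.flip_flip, OrientedCell.flip_flip⟩
    simp only [walkProb]
    rw [← e.tsum_eq (fun σ' => X.walkProb p σ₀ n σ' * X.transition p σ' σ.flip)]
    simp only [e, Equiv.coe_fn_mk, transition_flip, sub_mul]
    rw [Summable.tsum_sub (hs _ _) (hs (fun σ' => X.walkProb p σ₀ n σ'.flip) _)]
  · rfl

theorem expectation_zero (p : ℝ) (σ₀ σ : X.OrientedCell (k + 1)) :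
    X.expectation p σ₀ 0 σ = σ₀.dirac σ := by
  by_cases h : 2 ≤ k + 1
  · have h0 := OrientedCell.flip_ne h σ₀
    simp only [expectation, if_pos h, walkProb, OrientedCell.dirac]
    by_cases h1 : σ = σ₀
    · subst h1
      simp [h0]
    · by_cases h2 : σ = σ₀.flip
      · subst h2
        simp [h0]
      · have h3 : σ.flip ≠ σ₀ := fun e => h2 (OrientedCell.flip_eq_iff.1 e)
        simp [h1, h2, h3]
  · have h0 := OrientedCell.flip_eq_self_of_lt_two (by omega) σ₀
    simp only [expectation, if_neg h, walkProb, OrientedCell.dirac, h0]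
    split_ifs with h1 h2
    · rfl
    · exact absurd (h2.trans h0) h1
    · rfl

/-- The operator describing one step of the expectation process. -/
noncomputable def stepOperator (X : BoundedComplex V (k + 1)) (p : ℝ) :
    X.L2Form (k + 1) →L[ℝ] X.L2Form (k + 1) :=
  (p + (1 - p) / ((k : ℝ) + 1)) • 1 - ((1 - p) / ((k : ℝ) + 1)) • X.upperLaplacian

theorem expectation_eq (p : ℝ) (σ₀ : X.OrientedCell (k + 1)) (n : ℕ)
    (σ : X.OrientedCell (k + 1)) :
    X.expectation p σ₀ n σ = ((stepOperator X p ^ n) (diracForm σ₀)) σ := by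
  induction n generalizing σ with
  | zero => exact expectation_zero p σ₀ σ
  | succ n ih =>
    rw [expectation_succ]
    simp only [ih]
    obtain ⟨s, rfl⟩ := σ.exists_oriented_eq
    set f := (stepOperator X p ^ n) (diracForm σ₀) with hf
    rw [tsum_mul_transition_of_isForm p f.isForm s]
    have h1 : (stepOperator X p ^ (n + 1)) (diracForm σ₀)
        = (p + (1 - p) / ((k : ℝ) + 1)) • f
          + (-((1 - p) / ((k : ℝ) + 1))) • X.upperLaplacian f := by
      rw [pow_succ']
      show stepOperator X p f = _
      rw [stepOperator, neg_smul, ← sub_eq_add_neg]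
      rfl
    rw [h1, L2Form.add_apply, L2Form.smul_apply, L2Form.smul_apply, upperLaplacian_apply]
    ring

/-- The constant `c` for which the normalized expectation process is `(1 - c Δ⁺)ⁿ 𝟙_σ`. -/
noncomputable def laplacianRate (k : ℕ) (p : ℝ) : ℝ := (1 - p) / (p * k + 1)

theorem _root_.ContinuousLinearMap.smul_pow_apply {E : Type*} [NormedAddCommGroup E]
    [InnerProductSpace ℝ E] (c : ℝ) (T : E →L[ℝ] E) (n : ℕ) (x : E) :
    ((c • T) ^ n) x = c ^ n • (T ^ n) x := by
  rw [smul_pow]; rfl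

/-- The normalizing factor `(k+1)/(pk+1)` is the inverse of `p + (1-p)/(k+1)`, the coefficient of
the identity in `stepOperator`. -/
theorem normalizedExpectation_eq {p : ℝ} (hp : 0 ≤ p) (σ₀ : X.OrientedCell (k + 1)) (n : ℕ)
    (σ : X.OrientedCell (k + 1)) :
    X.normalizedExpectation p σ₀ n σ
      = (((1 - laplacianRate k p • X.upperLaplacian : X.L2Form (k + 1) →L[ℝ] X.L2Form (k + 1)) ^ n)
        (diracForm σ₀)) σ := by
  have hpos : 0 < p * k + 1 := by positivity
  have hk : (0 : ℝ) < k + 1 := by positivity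
  have h : (1 - laplacianRate k p • X.upperLaplacian : X.L2Form (k + 1) →L[ℝ] X.L2Form (k + 1))
      = (((k : ℝ) + 1) / (p * k + 1)) • stepOperator X p := by
    rw [stepOperator, laplacianRate]
    refine ContinuousLinearMap.ext fun f => L2Form.ext fun s => ?_
    show f s.oriented - (1 - p) / (p * k + 1) * X.upperLaplacian f s.oriented
      = ((k : ℝ) + 1) / (p * k + 1) * ((p + (1 - p) / ((k : ℝ) + 1)) * f s.oriented
        - (1 - p) / ((k : ℝ) + 1) * X.upperLaplacian f s.oriented)
    field_simp
    ring
  rw [normalizedExpectation, expectation_eq, h, ContinuousLinearMap.smul_pow_apply,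
    L2Form.smul_apply]
  push_cast
  rw [add_sub_cancel_right]

theorem propTAt_iff {p : ℝ} (hp : 1 / 2 ≤ p) (hp1 : p < 1) :
    X.PropTAt p ↔ ∀ σ : X.OrientedCell (k + 1), ∃ C : ℝ, ∀ y : X.L2Form (k + 1),
      inner ℝ (diracForm σ) y ^ 2 ≤ C * inner ℝ (X.upperLaplacian y) y := by
  have hp0 : 0 ≤ p := by linarith
  have hpos : 0 < p * k + 1 := by positivity
  have hc : 0 < laplacianRate k p := div_pos (by linarith) hpos
  have hle : ∀ y : X.L2Form (k + 1),
      laplacianRate k p * inner ℝ (X.upperLaplacian y) y ≤ ‖y‖ ^ 2 := by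
    intro y
    have h1 := inner_upperLaplacian_self_le y
    push_cast at h1
    -- This is where `1/2 ≤ p` enters: the inequality is equivalent to `(2p - 1)(k + 1) ≥ 0`, and `k
    -- + 2 = d + 1` bounds `Δ⁺`.
    have h2 : laplacianRate k p * ((k : ℝ) + 1 + 1) ≤ 1 := by
      rw [laplacianRate, div_mul_eq_mul_div, div_le_one hpos]
      have : (0 : ℝ) ≤ (2 * p - 1) * (k + 1) := mul_nonneg (by linarith) (by positivity)
      linarith
    calc _ ≤ laplacianRate k p * (((k : ℝ) + 1 + 1) * ‖y‖ ^ 2) := by gcongr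
      _ = (laplacianRate k p * ((k : ℝ) + 1 + 1)) * ‖y‖ ^ 2 := by ring
      _ ≤ 1 * ‖y‖ ^ 2 := by gcongr
      _ = _ := one_mul _
  refine forall_congr' fun σ => ?_
  rw [← (upperLaplacian_isPositive X).summable_inner_pow_iff hc hle]
  obtain ⟨s, rfl⟩ := σ.exists_oriented_eq
  have hw := X.weight_pos s
  rw [← summable_mul_left_iff hw.ne']
  refine summable_congr fun n => ?_
  rw [normalizedExpectation_eq hp0, ← inner_diracForm, real_inner_comm]

theorem eq_zero_of_forall_inner_diracForm {d n : ℕ} {X : BoundedComplex V d} {f : X.L2Form n}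
    (h : ∀ σ : X.OrientedCell n, inner ℝ (diracForm σ) f = 0) : f = 0 := by
  refine L2Form.ext fun s => ?_
  have := h s.oriented
  rw [inner_diracForm] at this
  exact (mul_eq_zero.1 this).resolve_left (X.weight_pos s).ne'

/-- With `𝟙_σ = ∂f`, Cauchy–Schwarz bounds `⟨f, ∂*y⟩²` by `‖f‖²⟨Δ⁺y, y⟩`. -/
theorem PropT'.propTAt (h : X.PropT') {p : ℝ} (hp : 1 / 2 ≤ p) (hp1 : p < 1) : X.PropTAt p := by
  rw [propTAt_iff hp hp1]
  intro σ
  obtain ⟨f, hf⟩ := h σ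
  have hf : X.boundary f = diracForm σ := L2Form.ext fun s => hf s.oriented
  refine ⟨‖f‖ ^ 2, fun y => ?_⟩
  rw [← hf, ← ContinuousLinearMap.adjoint_inner_right, inner_upperLaplacian_self, ← mul_pow,
    ← sq_abs (inner ℝ f _)]
  gcongr
  exact abs_real_inner_le_norm _ _

theorem propT'_of_isUnit (h : IsUnit X.upperLaplacian) : X.PropT' := by
  intro σ
  obtain ⟨u, hu⟩ := h
  refine ⟨ContinuousLinearMap.adjoint X.boundary ((↑u⁻¹ : X.L2Form (k + 1) →L[ℝ] X.L2Form (k + 1)) (diracForm σ)),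
    fun σ' => ?_⟩
  have : (X.upperLaplacian * (↑u⁻¹ : X.L2Form (k + 1) →L[ℝ] X.L2Form (k + 1))) (diracForm σ) = diracForm σ := by
    rw [← hu, Units.mul_inv]; rfl
  exact congrArg (fun f : X.L2Form (k + 1) => f σ') this

theorem upperLaplacian_injective_of_propTAt {p : ℝ} (hp : 1 / 2 ≤ p) (hp1 : p < 1)
    (h : X.PropTAt p) (y : X.L2Form (k + 1)) (hy : X.upperLaplacian y = 0) : y = 0 := by
  rw [propTAt_iff hp hp1] at h
  refine eq_zero_of_forall_inner_diracForm fun σ => ?_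
  obtain ⟨C, hC⟩ := h σ
  have := hC y
  rw [hy, inner_zero_left, mul_zero] at this
  exact pow_eq_zero_iff two_ne_zero |>.1 (le_antisymm this (sq_nonneg _))

end BoundedComplex

/-! ### Coboundaries, degrees of `(d-2)`-cells, and the restriction to cycles. -/

namespace BoundedComplex

open CellComplex

variable {V : Type*} {k : ℕ} {X : BoundedComplex V (k + 1)}

theorem one_le_deg (s : X.OrderedCell (k + 1)) : 1 ≤ X.deg s.cell := by
  have h := X.deg_pos s.mem (card_cell s)
  rw [deg_eq_card] at h ⊢
  exact_mod_cast h

theorem weight_eq_one_of_lt (s : X.OrderedCell k) : X.weight s.cell = 1 :=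
  if_neg (by rw [card_cell]; omega)

theorem coboundaryAt_eq (g : X.OrientedCell k → ℝ) (s : X.OrderedCell (k + 1)) :
    X.coboundaryAt g s
      = X.deg s.cell * ∑ p : Fin (k + 1), (-1) ^ (p : ℕ) * g (s.face p).oriented := by
  simp only [coboundaryAt, weight_eq_one_of_lt, mul_one]
  rw [weight_eq (card_cell s), one_div, inv_inv]

theorem exists_orderedCell {c : Finset V} {n : ℕ} (hc : c ∈ X.cells) (h : c.card = n) :
    ∃ s : X.OrderedCell n, s.cell = c := by
  have hmap : Finset.univ.map ((c.equivFinOfCardEq h).symm.toEmbedding.trans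
      (Function.Embedding.subtype (· ∈ c))) = c := by
    rw [← Finset.map_map, Finset.map_univ_equiv, ← Finset.attach_eq_univ, Finset.attach_map_val]
  exact ⟨⟨_, hmap.symm ▸ hc⟩, hmap⟩

/-- If all `(d-2)`-cells have infinite degree, there are no non-trivial `L²`-coboundaries. -/
theorem PropS.exactForms_eq_bot (h : X.PropS) : X.exactForms = ⊥ := by
  rw [eq_bot_iff]
  rintro f ⟨g, hg⟩
  rw [Submodule.mem_bot]
  have hg0 : ∀ c : X.OrderedCell k, g c.oriented = 0 := by
    intro c
    have hdeg := h c.cell c.mem (by rw [card_cell])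
    rw [degree_eq, Set.encard_eq_top_iff] at hdeg
    have : Infinite {v // X.Link c.cell v} := hdeg.to_subtype
    -- `u v` is the coboundary at `vc` without its degree factor. As `v` runs through infinitely
    -- many vertices, all terms except `g(c)` tend to `0` because `g` is square-summable, so `u v →
    -- g(c)`; square-summability of `f` gives `u v → 0`. Hence `g(c) = 0`.
    set u : {v // X.Link c.cell v} → ℝ := fun v =>
      ∑ p : Fin (k + 1), (-1) ^ (p : ℕ) * g ((c.cons v v.2).face p).oriented with hu
    have hlim1 : Filter.Tendsto u Filter.cofinite (nhds (g c.oriented)) := by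
      have hlim : ∀ p : Fin k, Filter.Tendsto
          (fun v : {v // X.Link c.cell v} => g ((c.cons v v.2).face p.succ).oriented)
          Filter.cofinite (nhds 0) := by
        intro p
        have hinj : Function.Injective
            (fun v : {v // X.Link c.cell v} => (c.cons v v.2).face p.succ) := by
          intro v w hvw
          have hp : 0 < k := p.pos
          have : ∀ v : {v // X.Link c.cell v}, ((c.cons v v.2).face p.succ).vert ⟨0, hp⟩ = v := by
            intro v
            show (c.cons v v.2).vert (p.succ.succAbove ⟨0, hp⟩) = v
            have : p.succ.succAbove ⟨0, hp⟩ = 0 := by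
              rw [Fin.succAbove_of_castSucc_lt _ _ (by simp [Fin.lt_def])]
              rfl
            rw [this]
            rfl
          refine Subtype.ext ?_
          rw [← this v, ← this w]
          simp only at hvw
          rw [hvw]
        have h1 := g.summable_sq.tendsto_cofinite_zero.comp hinj.tendsto_cofinite
        have h2 : Filter.Tendsto (fun v : {v // X.Link c.cell v} =>
            |g ((c.cons v v.2).face p.succ).oriented|) Filter.cofinite (nhds 0) := by
          have h3 := h1.sqrt
          rw [Real.sqrt_zero] at h3
          refine h3.congr fun v => ?_
          simp only [Function.comp_apply, weight_eq_one_of_lt, one_mul, Real.sqrt_sq_eq_abs]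
        exact (tendsto_zero_iff_abs_tendsto_zero _).2 h2
      have h4 : ∀ v, u v = g c.oriented + ∑ p : Fin k, (-1) ^ ((p.succ : Fin (k + 1)) : ℕ) *
          g ((c.cons v v.2).face p.succ).oriented := by
        intro v
        rw [hu]
        simp only
        rw [Fin.sum_univ_succ]
        congr 1
        rw [Fin.val_zero, pow_zero, one_mul]
        rfl
      have h5 := (tendsto_const_nhds (x := g c.oriented)).add
        (tendsto_finsetSum Finset.univ fun p _ => (hlim p).const_mul
          ((-1 : ℝ) ^ ((p.succ : Fin (k + 1)) : ℕ)))
      simp only [mul_zero, Finset.sum_const_zero, add_zero] at h5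
      exact h5.congr fun v => (h4 v).symm
    have hlim2 : Filter.Tendsto (fun v => u v ^ 2) Filter.cofinite (nhds 0) := by
      have hinj : Function.Injective (fun v : {v // X.Link c.cell v} => c.cons v v.2) := by
        intro v w hvw
        have : (c.cons v v.2).vert 0 = (c.cons w w.2).vert 0 := by
          simp only at hvw
          rw [hvw]
        exact Subtype.ext this
      have h1 := f.summable_sq.tendsto_cofinite_zero.comp hinj.tendsto_cofinite
      -- The weighted square of `f(vc)` is `deg(vc) u(v)²`, which dominates `u(v)²` as degrees are
      -- at least `1`.
      refine squeeze_zero (fun v => sq_nonneg _) (fun v => ?_) h1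
      have hd := one_le_deg (c.cons v v.2)
      simp only [Function.comp_apply]
      rw [hg, coboundaryAt_eq, weight_eq (card_cell _)]
      have : 1 / X.deg (c.cons v v.2).cell * (X.deg (c.cons v v.2).cell * u v) ^ 2
          = X.deg (c.cons v v.2).cell * u v ^ 2 := by
        field_simp
      show u v ^ 2 ≤ 1 / X.deg (c.cons v v.2).cell * (X.deg (c.cons v v.2).cell * u v) ^ 2
      rw [this]
      nlinarith [sq_nonneg (u v)]
    have h6 := tendsto_nhds_unique (hlim1.pow 2) hlim2
    exact pow_eq_zero_iff two_ne_zero |>.1 h6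
  refine L2Form.ext fun s => ?_
  rw [hg, coboundaryAt_eq]
  simp [hg0]

/-- The coboundary of the Dirac form of a `(d-2)`-cell of finite degree, as an `L²`-form. -/
theorem exists_coboundary_diracForm (c : X.OrderedCell k) (hc : X.degree c.cell ≠ ⊤) :
    ∃ f : X.L2Form (k + 1), ∀ s : X.OrderedCell (k + 1),
      f s.oriented = X.coboundaryAt c.oriented.dirac s := by
  have hperm : ∀ (s : X.OrderedCell (k + 1)) (π : Equiv.Perm (Fin (k + 1))),
      X.coboundaryAt c.oriented.dirac (s.perm π)
        = ((Equiv.Perm.sign π : ℤ) : ℝ) * X.coboundaryAt c.oriented.dirac s := by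
    intro s π
    rw [coboundaryAt_eq, coboundaryAt_eq, OrderedCell.cell_perm,
      alternating_sum_face_perm (G := fun s => c.oriented.dirac s.oriented)
        (fun s e => (OrientedCell.isForm_dirac _).perm s e)]
    ring
  have hfin : Finite {v // X.Link c.cell v} := by
    rw [degree_eq, Ne, Set.encard_eq_top_iff, Set.not_infinite] at hc
    exact hc.to_subtype
  -- The support consists of orderings of cells `vc` with `v` in the link of `c`, finitely many when
  -- `c` has finite degree.
  have hsupp : (Function.support fun s : X.OrderedCell (k + 1) =>
      X.coboundaryAt c.oriented.dirac s) ⊆ Set.range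
        (fun q : {v // X.Link c.cell v} × Equiv.Perm (Fin (k + 1)) => (c.cons q.1 q.1.2).perm q.2) := by
    intro s hs
    rw [Function.mem_support, coboundaryAt_eq] at hs
    obtain ⟨p, -, hp⟩ := Finset.exists_ne_zero_of_sum_ne_zero (right_ne_zero_of_mul hs)
    obtain ⟨π, hπ⟩ := OrientedCell.exists_perm_of_dirac_ne_zero (right_ne_zero_of_mul hp)
    have h1 := s.link_face p
    have h2 := s.cons_face p h1
    have h3 : X.Link (c.perm π).cell (s.vert p) := by rw [hπ]; exact h1
    have h4 : X.Link c.cell (s.vert p) := by rwa [OrderedCell.cell_perm] at h3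
    refine ⟨(⟨s.vert p, h4⟩, Equiv.Perm.decomposeFin.symm (0, π) * (p.cycleRange.symm)⁻¹), ?_⟩
    simp only
    rw [← OrderedCell.perm_perm, ← cons_perm c π _ h4 h3]
    have h5 : (c.perm π).cons (s.vert p) h3 = (s.face p).cons (s.vert p) h1 := by
      congr 1
    rw [h5, h2, OrderedCell.perm_perm, mul_inv_cancel, OrderedCell.perm_one]
  refine ⟨L2Form.mk (Quotient.lift (X.coboundaryAt c.oriented.dirac) ?_) ?_ ?_, fun s => rfl⟩
  · rintro s t ⟨π, h, rfl⟩
    rw [hperm, h]; simp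
  · intro h2 σ
    obtain ⟨s, rfl⟩ := σ.exists_oriented_eq
    show X.coboundaryAt c.oriented.dirac (s.perm (flipPerm (k + 1)))
      = - X.coboundaryAt c.oriented.dirac s
    rw [hperm, sign_flipPerm h2]; simp
  · refine summable_of_hasFiniteSupport ((Set.finite_range _).subset (Set.Subset.trans ?_ hsupp))
    intro s hs h0
    refine hs ?_
    show X.weight s.cell * (X.coboundaryAt c.oriented.dirac s) ^ 2 = 0
    have h0 : X.coboundaryAt c.oriented.dirac s = 0 := h0
    rw [h0]; simp

/-- If `c` has finite degree, `δ𝟙_c` is an `L²`-coboundary, and it is nonzero: its value at `vc` is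
`deg(vc) ≥ 1`, since every face of `vc` other than `c` contains `v`. -/
theorem propS_of_exactForms_eq_bot (h : X.exactForms = ⊥) : X.PropS := by
  intro c hc hcard
  by_contra hdeg
  obtain ⟨c, rfl⟩ := exists_orderedCell (n := k) hc (by omega)
  obtain ⟨f, hf⟩ := exists_coboundary_diracForm c hdeg
  have hf0 : f = 0 := by
    have : f ∈ X.exactForms := ⟨diracForm c.oriented, hf⟩
    rwa [h, Submodule.mem_bot] at this
  obtain ⟨t, ht, hct, htcard⟩ := X.uniform c.cell hc
  obtain ⟨v, hvt, hvc⟩ : ∃ v ∈ t, v ∉ c.cell := by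
    by_contra! hh
    have := Finset.card_le_card (show t ⊆ c.cell from hh)
    omega
  have hv : X.Link c.cell v := ⟨hvc, X.down_closed t ht _ (by
    intro x hx
    rcases Finset.mem_cons.1 hx with rfl | hx
    exacts [hvt, hct hx])⟩
  have h1 := hf (c.cons v hv)
  rw [hf0, L2Form.zero_apply, coboundaryAt_eq, Fin.sum_univ_succ, Finset.sum_eq_zero] at h1
  · have h2 : c.oriented.dirac ((c.cons v hv).face 0).oriented = 1 := OrientedCell.dirac_self _
    rw [h2] at h1
    have := one_le_deg (c.cons v hv)
    simp at h1
    linarith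
  · intro p _
    by_contra hne
    obtain ⟨π, hπ⟩ := OrientedCell.exists_perm_of_dirac_ne_zero (right_ne_zero_of_mul hne)
    have hcell : c.cell = ((c.cons v hv).face p.succ).cell := by
      rw [← hπ, OrderedCell.cell_perm]
    refine hvc (hcell ▸ ?_)
    have h0 := Fin.exists_succAbove_eq (Fin.succ_ne_zero p).symm
    obtain ⟨j, hj⟩ := h0
    have := ((c.cons v hv).face p.succ).vert_mem_cell j
    have hv' : ((c.cons v hv).face p.succ).vert j = v := by
      show (c.cons v hv).vert (p.succ.succAbove j) = v
      rw [hj]; rfl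
    rwa [hv'] at this

theorem exactForms_eq_bot_of_isUnit (h : IsUnit X.upperLaplacian) : X.exactForms = ⊥ := by
  rw [eq_bot_iff]
  intro b hb
  have h1 : ContinuousLinearMap.adjoint X.boundary b = 0 := by
    refine ext_inner_left ℝ fun f => ?_
    rw [ContinuousLinearMap.adjoint_inner_right, inner_boundary_exact f b hb, inner_zero_right]
  have h2 : X.upperLaplacian b = X.upperLaplacian 0 := by
    rw [upperLaplacian, ContinuousLinearMap.comp_apply, h1, map_zero, map_zero]
  exact (ContinuousLinearMap.isUnit_iff_bijective.1 h).1 h2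

theorem PropT'.exactForms_eq_bot (h : X.PropT') : X.exactForms = ⊥ := by
  rw [eq_bot_iff]
  intro b hb
  refine eq_zero_of_forall_inner_diracForm fun σ => ?_
  obtain ⟨f, hf⟩ := h σ
  have hf : X.boundary f = diracForm σ := L2Form.ext fun s => hf s.oriented
  rw [← hf]
  exact inner_boundary_exact f b hb

theorem cycleLaplacian_isPositive (X : BoundedComplex V (k + 1)) :
    X.cycleLaplacian.IsPositive := by
  refine (ContinuousLinearMap.isPositive_iff _).2 ⟨fun x y => ?_, fun x => ?_⟩
  · exact (upperLaplacian_isPositive X).inner_left_eq_inner_right (x : X.L2Form (k + 1)) y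
  · exact (upperLaplacian_isPositive X).inner_nonneg_left (x : X.L2Form (k + 1))

/-- Without coboundaries the space of cycles is everything, so the restriction is `Δ⁺` transported
along a bijection. -/
theorem isUnit_cycleLaplacian_iff (h : X.exactForms = ⊥) :
    IsUnit X.cycleLaplacian ↔ IsUnit X.upperLaplacian := by
  have htop : ∀ x, x ∈ X.cycles := by
    intro x
    rw [cycles, h, Submodule.bot_orthogonal_eq_top]
    exact Submodule.mem_top
  have : CompleteSpace X.cycles := inferInstanceAs (CompleteSpace X.exactFormsᗮ)
  rw [ContinuousLinearMap.isUnit_iff_bijective, ContinuousLinearMap.isUnit_iff_bijective]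
  let e : X.cycles ≃ X.L2Form (k + 1) := Equiv.subtypeUnivEquiv htop
  have he : (e ∘ X.cycleLaplacian : X.cycles → X.L2Form (k + 1)) = X.upperLaplacian ∘ e := rfl
  rw [← e.comp_bijective, he, e.bijective_comp]

theorem propA'_iff : X.PropA' ↔ ¬ IsUnit X.upperLaplacian :=
  (upperLaplacian_isPositive X).zero_isLeast_spectrum_iff

theorem propA_iff : X.PropA ↔ ¬ IsUnit X.cycleLaplacian := by
  have : CompleteSpace X.cycles := inferInstanceAs (CompleteSpace X.exactFormsᗮ)
  exact (cycleLaplacian_isPositive X).zero_isLeast_spectrum_iff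

end BoundedComplex

theorem proposition3p17 {V : Type*} {k : ℕ} (X : BoundedComplex V (k + 1)) :
    (X.PropA → X.PropA') ∧
    (X.PropA' → X.PropS → X.PropA) ∧
    (¬ X.PropA' → X.PropT') ∧
    (X.PropT' → X.PropS) ∧
    (¬ X.PropA' → X.PropT) ∧
    (∀ p q : ℝ, 1 / 2 ≤ p → p < 1 → 1 / 2 ≤ q → q < 1 → X.PropTAt p → X.PropTAt q) ∧
    ((0 ∈ spectrum ℝ X.upperLaplacian ∧
        ∃ ε > 0, ∀ x ∈ spectrum ℝ X.upperLaplacian, |x| < ε → x = 0) →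
      ¬ X.PropT) := by
  open BoundedComplex in
  refine ⟨fun hA => ?_, fun hA' hS => ?_, fun hA' => ?_, fun hT' => ?_, fun hA' => ?_,
    fun p q hp hp1 hq hq1 hT => ?_, ?_⟩
  · rw [propA'_iff]
    intro hu
    exact propA_iff.1 hA ((isUnit_cycleLaplacian_iff (exactForms_eq_bot_of_isUnit hu)).2 hu)
  · rw [propA_iff, isUnit_cycleLaplacian_iff hS.exactForms_eq_bot]
    exact propA'_iff.1 hA'
  · rw [propA'_iff, not_not] at hA'
    exact propT'_of_isUnit hA'
  · exact propS_of_exactForms_eq_bot hT'.exactForms_eq_bot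
  · rw [propA'_iff, not_not] at hA'
    exact ⟨1 / 2, le_rfl, by norm_num, (propT'_of_isUnit hA').propTAt le_rfl (by norm_num)⟩
  · exact (propTAt_iff hq hq1).2 ((propTAt_iff hp hp1).1 hT)
  · rintro ⟨h0, ε, hε, hs⟩ ⟨p, hp, hp1, hT⟩
    exact (spectrum.zero_mem_iff ℝ).1 h0 ((upperLaplacian_isPositive X).isUnit_of_injective_of_gap
      (upperLaplacian_injective_of_propTAt hp hp1 hT) hε hs)
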